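/- Let $G=(V,E)$ be a simple undirected graph with $V=\{0,\dots,n-1\}$, $n\ge 1$. For $\emptyset\ne S\subseteq V$ let $\rho(S)=|E(S)|/|S|$, where $E(S)$ is the set of edges with both endpoints in $S$, and let $\rho^*(G)=\max_{\emptyset\ne S\subseteq V}\rho(S)$. In the incidence-list model, $n$ is known and $G$ is accessed through an oracle that answers degree queries (the degree of a node $v$) and neighbor queries (the $i$-th entry of the incidence list of $v$, the order of each list being arbitrary). Algorithms are programs of a randomized random-access machine: a step is an arithmetic operation or comparison on words, a memory access, a control step, an oracle query, or the drawing of a uniformly random element of $\{0,\dots,a-1\}$ for a word $a$; time is the number of steps, and space is the number of registers and memory cells used times the word length, in bits. For every constant $c\in\mathbb N$ there are a program $\mathcal A$ and constants $C,k\in\mathbb N$, depending only on $c$, such that for every real $\varepsilon>0$, every $n\ge1$, every graph $G$ on $n$ nodes and every incidence-list representation of $G$, the following holds when $\mathcal A$ is started with input $(n,\lceil 1/\varepsilon\rceil)$. Put $B=C\,n\,\bigl((1+\log n)(1+1/\varepsilon)\bigr)^{k}$, so that $B=\tilde O(n)$, where $\tilde O$ hides factors polynomial in $\log n$ and $1/\varepsilon$.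 (1) For all outcomes of its random choices, $\mathcal A$ halts after at most $B$ steps, makes at most $B$ oracle queries and uses at most $B$ bits of space, and all words have at most $C\,(1+\log n+\log(1+1/\varepsilon))$ bits. (2) With probability at least $1-n^{-c}$, $\mathcal A$ outputs a $(2+\varepsilon)$-approximate solution to the densest subgraph problem on $G$: a number $\eta$ with $\rho^*(G)/(2+\varepsilon)\le\eta\le\rho^*(G)$ and a nonempty set $S\subseteq V$ with $(2+\varepsilon)\,\rho(S)\ge\rho^*(G)$. -/

import Mathlib

namespace DensestSubgraph

noncomputable section

/-! ### Density -/

/-- The density `ρ(S) = |E(S)| / |S|`, where `E(S)` is the set of edges with both endpoints in `S`.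
(For `S = ∅` the value is `0`; since densities are nonnegative, this does not affect maxima.) -/
def density {V : Type*} (G : SimpleGraph V) (S : Finset V) : ℝ :=
  (Set.ncard {e ∈ G.edgeSet | ∀ v ∈ e, v ∈ S} : ℝ) / (S.card : ℝ)

/-- The maximum density `ρ*(G)` of a finite graph: the maximum of `ρ(S)` over all `S ⊆ V`. -/
def maxDensity {V : Type*} [Fintype V] (G : SimpleGraph V) : ℝ :=
  ⨆ S : Finset V, density G S

/-! ### The incidence-list oracle -/

/-- An incidence-list representation of a graph on the nodes `0, …, n - 1`: for each node, a list of
its neighbors, each occurring exactly once, in an arbitrary order. -/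
structure IncidenceList {n : ℕ} (G : SimpleGraph (Fin n)) where
  nbrs : Fin n → List (Fin n)
  nodup : ∀ v, (nbrs v).Nodup
  mem_iff : ∀ v u, u ∈ nbrs v ↔ G.Adj v u

/-- Degree query: the degree of the node `v` (and `0` if `v` is not a node). -/
def IncidenceList.degreeQuery {n : ℕ} {G : SimpleGraph (Fin n)} (I : IncidenceList G) (v : ℕ) : ℕ :=
  if h : v < n then (I.nbrs ⟨v, h⟩).length else 0

/-- Neighbor query: the `i`-th entry (counting from `0`) of the incidence list of the node `v`.
If there is no such entry, the answer is `n`, which is not the name of a node. -/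
def IncidenceList.neighborQuery {n : ℕ} {G : SimpleGraph (Fin n)} (I : IncidenceList G)
    (v i : ℕ) : ℕ :=
  if h : v < n then
    if h' : i < (I.nbrs ⟨v, h⟩).length then ((I.nbrs ⟨v, h⟩)[i] : Fin n).val else n
  else n

/-! ### Randomized random-access machines with oracle access to a graph -/

/-- Arithmetic and comparison operations on words. -/
inductive Op
  | add | sub | mul | div | mod | lt | eq

/-- Subtraction is truncated at `0`, division rounds down, comparisons return `1` or `0`. -/
def Op.eval : Op → ℕ → ℕ → ℕ
  | .add, a, b => a + b
  | .sub, a, b => a - b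
  | .mul, a, b => a * b
  | .div, a, b => a / b
  | .mod, a, b => a % b
  | .lt, a, b => if a < b then 1 else 0
  | .eq, a, b => if a = b then 1 else 0

/-- Programs of the machine. The data are finitely many registers and a random-access memory;
`r, a, b, v, i` below are register numbers. -/
inductive Prog
  /-- do nothing -/
  | skip
  /-- `r := k` for a literal `k` -/
  | const (r k : ℕ)
  /-- `r := a ∘ b` -/
  | op (o : Op) (r a b : ℕ)
  /-- `r := memory[a]` -/
  | load (r a : ℕ)
  /-- `memory[a] := b` -/
  | store (a b : ℕ)
  /-- `r :=` a fresh uniformly random element of `{0, …, a - 1}` -/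
  | rand (r a : ℕ)
  /-- `r :=` degree of the node `v` (oracle query) -/
  | degree (r v : ℕ)
  /-- `r :=` the `i`-th neighbor of the node `v` (oracle query) -/
  | neighbor (r v i : ℕ)
  /-- sequential composition -/
  | seq (p q : Prog)
  /-- if register `r` is nonzero then `p` else `q` -/
  | cond (r : ℕ) (p q : Prog)
  /-- while register `r` is nonzero do `p` -/
  | loop (r : ℕ) (p : Prog)

/-- One plus the largest register number that occurs in the program. -/
def Prog.numRegs : Prog → ℕ
  | .skip => 0
  | .const r _ => r + 1
  | .op _ r a b => max r (max a b) + 1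
  | .load r a => max r a + 1
  | .store a b => max a b + 1
  | .rand r a => max r a + 1
  | .degree r v => max r v + 1
  | .neighbor r v i => max r (max v i) + 1
  | .seq p q => max p.numRegs q.numRegs
  | .cond r p q => max (r + 1) (max p.numRegs q.numRegs)
  | .loop r p => max (r + 1) p.numRegs

/-- The data of the machine together with its resource meters. -/
structure State where
  /-- contents of the registers -/
  reg : ℕ → ℕ
  /-- contents of the memory -/
  mem : ℕ → ℕ
  /-- number of oracle queries made so far -/
  queries : ℕ
  /-- least `t` such that all memory addresses accessed so far are smaller than `t` -/
  memTop : ℕ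
  /-- largest number held by a register or a memory cell so far -/
  maxWord : ℕ

/-- Write `x` into the register `r`. -/
def State.setReg (s : State) (r x : ℕ) : State :=
  { s with reg := Function.update s.reg r x, maxWord := max s.maxWord x }

/-- Record an access to the memory address `a`. -/
def State.touch (s : State) (a : ℕ) : State :=
  { s with memTop := max s.memTop (a + 1) }

/-- Write `x` into the memory cell with address `a`. The value comes from a register, so `maxWord`
does not change. -/
def State.setMem (s : State) (a x : ℕ) : State :=
  { s.touch a with mem := Function.update s.mem a x }

/-- Record an oracle query. -/
def State.countQuery (s : State) : State :=
  { s with queries := s.queries + 1 }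

/-- The initial state: the input consists of the number `n` of nodes (in register `0`) and an
accuracy parameter `k` (in register `1`); everything else is zero. -/
def State.init (n k : ℕ) : State where
  reg := fun r => if r = 0 then n else if r = 1 then k else 0
  mem := fun _ => 0
  queries := 0
  memTop := 0
  maxWord := max n k

/-- The uniform distribution on `{0, …, k - 1}` (for `k = 0`: the constant `0`). -/
def uniformBelow (k : ℕ) : PMF ℕ :=
  if h : 0 < k then PMF.uniformOfFinset (Finset.range k) ⟨0, Finset.mem_range.mpr h⟩ else PMF.pure 0

/-- A configuration: the stack of programs that remain to be executed, and the state. The machine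
has halted when the stack is empty. -/
abbrev Config := List Prog × State

/-- One step of the machine; its result is random. -/
def step {n : ℕ} {G : SimpleGraph (Fin n)} (I : IncidenceList G) : Config → PMF Config
  | ([], s) => PMF.pure ([], s)
  | (.skip :: K, s) => PMF.pure (K, s)
  | (.const r k :: K, s) => PMF.pure (K, s.setReg r k)
  | (.op o r a b :: K, s) => PMF.pure (K, s.setReg r (o.eval (s.reg a) (s.reg b)))
  | (.load r a :: K, s) => PMF.pure (K, (s.touch (s.reg a)).setReg r (s.mem (s.reg a)))
  | (.store a b :: K, s) => PMF.pure (K, s.setMem (s.reg a) (s.reg b))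
  | (.rand r a :: K, s) => (uniformBelow (s.reg a)).map fun x => (K, s.setReg r x)
  | (.degree r v :: K, s) => PMF.pure (K, s.countQuery.setReg r (I.degreeQuery (s.reg v)))
  | (.neighbor r v i :: K, s) =>
      PMF.pure (K, s.countQuery.setReg r (I.neighborQuery (s.reg v) (s.reg i)))
  | (.seq p q :: K, s) => PMF.pure (p :: q :: K, s)
  | (.cond r p q :: K, s) => PMF.pure ((if s.reg r ≠ 0 then p else q) :: K, s)
  | (.loop r p :: K, s) => PMF.pure (if s.reg r ≠ 0 then p :: .loop r p :: K else K, s)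

/-- The distribution of the configuration after `t` steps. -/
def run {n : ℕ} {G : SimpleGraph (Fin n)} (I : IncidenceList G) : ℕ → Config → PMF Config
  | 0, c => PMF.pure c
  | t + 1, c => (step I c).bind (run I t)

/-- The number of bits of the longest word held so far. -/
def State.wordBits (s : State) : ℕ := Nat.size s.maxWord

/-- The space, in bits, that the program `p` has used when it is in the state `s`: the number of its
registers and memory cells, times the word length. -/
def spaceBits (p : Prog) (s : State) : ℕ := (p.numRegs + s.memTop) * s.wordBits

/-! ### Outputs -/

/-- The output number: the fraction whose numerator and denominator are in registers `0` and `1`. -/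
def State.outValue (s : State) : ℝ := (s.reg 0 : ℝ) / (s.reg 1 : ℝ)

/-- The output set of nodes: its indicator vector is in the memory cells `0, …, n - 1`. -/
def State.outSet (s : State) (n : ℕ) : Finset (Fin n) :=
  Finset.univ.filter fun v => s.mem v ≠ 0

/-- The output is a `γ`-approximate solution of the densest subgraph problem on `G`: the output number
`η` is a `γ`-approximate value, `ρ*(G) / γ ≤ η ≤ ρ*(G)`, and the output set `S` is a `γ`-approximate
densest subgraph, `γ · ρ(S) ≥ ρ*(G)`. -/
def IsApproxSolution {n : ℕ} (G : SimpleGraph (Fin n)) (γ : ℝ) (s : State) : Prop :=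
  s.reg 1 ≠ 0 ∧ maxDensity G / γ ≤ s.outValue ∧ s.outValue ≤ maxDensity G ∧
    (s.outSet n).Nonempty ∧ maxDensity G ≤ γ * density G (s.outSet n)

end

end DensestSubgraph

/-!
The algorithm samples the graph and solves the problem approximately on the sample by peeling.

*Sampling.* Let `D` be the sum of the degrees and `q = M · size n · k² · n` with `k = ⌈1 / ε⌉` and
`M = 1024 (c + 3)`. Every incidence list is cut into intervals of length `w = ⌊D / q⌋` (or `1` if this
is `0`), and one uniformly random position is read in each interval, which makes at most
`D / w + n = O(q)` draws. An edge inside a set `S` of nodes occupies two entries of incidence lists,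
so the sample is expected to contain `2 |E(S)| / w` pairs inside `S`. This number of pairs is a sum
of independent indicators. If `w = ⌊D / q⌋`, then `D ≤ 2 n ρ*` gives `2 ρ* / w ≥ q / n`, and the
choice of `q` makes the deviation from the mean exceed `2 ρ* |S| / (16 k w)` with probability at most
`2 n ^ (-(c + 3) |S|)` (`deviation_le`). For `n ≥ 2` these bounds sum to at most `n ^ (-c)` over all
nonempty sets `S` (`exists_deviation_le`, `sample_concentrated`). If `w = 1`, the sample is the whole
graph and nothing is left to chance.

*Peeling.* Put `K = 16 k`. Starting from all nodes, every round removes all nodes whose degree in the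
sample is at most `2 (1 + 1 / K)` times the current density, and the densest set seen so far is kept.
Since the degrees sum to twice the number of pairs, each round shrinks the set by the factor
`1 + 1 / K`, so nothing is left after `K · size n` rounds (`survivors_eq_empty`). When the first
node of a densest set `S` of the sample is removed, its degree is at least the density of `S`; hence
the set at this time has at least the density of `S` divided by `2 (1 + 1 / K)`
(`Best.edgeCount_le`). On a concentrated sample this carries over to the graph
(`Best.isApproxSolution`).

*The program.* The judgement `Runs` bounds the time, the word size and the memory of a program and
describes the joint law of its result and of a ghost value, here the sample. It has rules for
sequential composition, branching, counting loops and straight-line code (`wp`), and it yields the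
specification `runs_mainProg` of the whole program, from which all resource bounds follow.
-/

namespace DensestSubgraph

open scoped ENNReal

/-! ### Runs of the machine -/

theorem _root_.PMF.bind_congr_support {α β : Type*} {μ : PMF α} {f g : α → PMF β}
    (h : ∀ a ∈ μ.support, f a = g a) : μ.bind f = μ.bind g := by
  ext b
  simp only [PMF.bind_apply]
  refine tsum_congr fun a => ?_
  by_cases ha : μ a = 0
  · simp [ha]
  · rw [h a ((PMF.mem_support_iff _ _).2 ha)]

section Machine

variable {n : ℕ} {G : SimpleGraph (Fin n)} (I : IncidenceList G)

theorem run_halted (t : ℕ) (s : State) : run I t ([], s) = PMF.pure ([], s) := by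
  induction t with
  | zero => rfl
  | succ t ih => simp [run, step, ih]

theorem run_add (a b : ℕ) (c : Config) : run I (a + b) c = (run I a c).bind (run I b) := by
  induction a generalizing c with
  | zero => simp [run]
  | succ a ih =>
    rw [Nat.succ_add]
    simp only [run, PMF.bind_bind]
    congr 1
    funext x
    exact ih x

/-- Every execution from the configuration `c` halts within `T` steps. -/
def Halts (T : ℕ) (c : Config) : Prop := ∀ x ∈ (run I T c).support, x.1 = []

variable {I}

theorem Halts.run_add {T : ℕ} {c : Config} (h : Halts I T c) (b : ℕ) :
    run I (T + b) c = run I T c := by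
  rw [DensestSubgraph.run_add]
  conv_rhs => rw [← PMF.bind_pure (run I T c)]
  refine PMF.bind_congr_support ?_
  rintro ⟨K, s⟩ hx
  obtain rfl : K = [] := h _ hx
  exact run_halted I b s

theorem Halts.mono {T T' : ℕ} {c : Config} (h : Halts I T c) (hT : T ≤ T') : Halts I T' c := by
  obtain ⟨b, rfl⟩ := Nat.exists_eq_add_of_le hT
  unfold Halts
  rw [h.run_add]
  exact h

variable (I)

/-- `Exec I p s t ν`: started in the state `s`, the program `p` ends within `t` steps, and its final
state is distributed like the second component of `ν`. The first component is a ghost value, a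
function of the random draws that need not be visible in the state. The definition speaks about all
continuations `K`, which makes it compositional; the number of steps may depend on the random
draws, so two executions are compared only after the continuation has halted. -/
def Exec {α : Type} (p : Prog) (s : State) (t : ℕ) (ν : PMF (α × State)) : Prop :=
  ∀ (K : List Prog) (T : ℕ), (∀ x ∈ ν.support, Halts I T (K, x.2)) →
    run I (t + T) (p :: K, s) = ν.bind fun x => run I T (K, x.2)

variable {I}
variable {α β : Type}

theorem Exec.mono {p : Prog} {s : State} {t t' : ℕ} {ν : PMF (α × State)} (h : Exec I p s t ν)
    (ht : t ≤ t') : Exec I p s t' ν := by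
  obtain ⟨b, rfl⟩ := Nat.exists_eq_add_of_le ht
  intro K T hT
  have := h K (T + b) fun x hx => (hT x hx).mono (Nat.le_add_right _ _)
  rw [show t + b + T = t + (T + b) by ring, this]
  exact PMF.bind_congr_support fun x hx => (hT x hx).run_add b

/-- A program that ends in a single step. -/
theorem Exec.atom {p : Prog} {s : State} {ν : PMF (α × State)}
    (h : ∀ K, step I (p :: K, s) = ν.map fun x => (K, x.2)) : Exec I p s 1 ν := by
  intro K T _
  rw [Nat.add_comm, run, h, PMF.bind_map]
  rfl

/-- A program whose first step replaces it by `p` followed by `q`. -/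
theorem Exec.pair {P p q : Prog} {s : State} {t₁ t₂ : ℕ} {ν : PMF (α × State)}
    {κ : α × State → PMF (β × State)}
    (h : ∀ K, step I (P :: K, s) = PMF.pure (p :: q :: K, s))
    (h₁ : Exec I p s t₁ ν) (h₂ : ∀ x ∈ ν.support, Exec I q x.2 t₂ (κ x)) :
    Exec I P s (1 + t₁ + t₂) (ν.bind κ) := by
  intro K T hT
  have key : ∀ x ∈ ν.support, run I (t₂ + T) (q :: K, x.2) =
      (κ x).bind fun y => run I T (K, y.2) := fun x hx =>
    h₂ x hx K T fun y hy => hT y ((PMF.mem_support_bind_iff _ _ _).2 ⟨x, hx, hy⟩)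
  rw [show 1 + t₁ + t₂ + T = (t₁ + (t₂ + T)) + 1 by ring, run, h, PMF.pure_bind,
    h₁ (q :: K) (t₂ + T), PMF.bind_bind]
  · exact PMF.bind_congr_support key
  · intro x hx y hy
    rw [key x hx, PMF.mem_support_bind_iff] at hy
    obtain ⟨z, hz, hy⟩ := hy
    exact hT z ((PMF.mem_support_bind_iff _ _ _).2 ⟨x, hx, hz⟩) y hy

/-- A program whose first step replaces it by `p`. -/
theorem Exec.single {P p : Prog} {s : State} {t : ℕ} {ν : PMF (α × State)}
    (h : ∀ K, step I (P :: K, s) = PMF.pure (p :: K, s)) (h₁ : Exec I p s t ν) :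
    Exec I P s (1 + t) ν := by
  intro K T hT
  rw [show 1 + t + T = (t + T) + 1 by ring, run, h, PMF.pure_bind, h₁ K T hT]

theorem Exec.run_eq {p : Prog} {s : State} {t : ℕ} {ν : PMF (α × State)} (h : Exec I p s t ν) :
    run I t ([p], s) = ν.map fun x => ([], x.2) := by
  have := h [] 0 fun x _ y hy => by
    rw [run_halted, PMF.mem_support_pure_iff] at hy
    rw [hy]
  rw [Nat.add_zero] at this
  rw [this]
  simp only [run_halted]
  rfl

theorem queries_le_of_mem_support_step {c x : Config} (hx : x ∈ (step I c).support) :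
    x.2.queries ≤ c.2.queries + 1 := by
  obtain ⟨K, s⟩ := c
  rcases K with _ | ⟨p, K⟩
  · simp [step] at hx; simp [hx]
  · cases p <;> simp [step] at hx
    case rand => obtain ⟨a, -, rfl⟩ := hx; simp [State.setReg]
    all_goals simp [hx, State.setReg, State.setMem, State.touch, State.countQuery]

theorem queries_le_of_mem_support_run {T : ℕ} {c x : Config} (hx : x ∈ (run I T c).support) :
    x.2.queries ≤ c.2.queries + T := by
  induction T generalizing c with
  | zero => simp [run] at hx; simp [hx]
  | succ T ih =>
    rw [run, PMF.mem_support_bind_iff] at hx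
    obtain ⟨y, hy, hx⟩ := hx
    have := queries_le_of_mem_support_step hy
    have := ih hx
    omega

/-! ### A program logic -/

/-- All words that occur are at most `W` and all addresses that were accessed are below `A`. -/
structure State.Within (W A : ℕ) (s : State) : Prop where
  maxWord : s.maxWord ≤ W
  memTop : s.memTop ≤ A
  reg : ∀ r, s.reg r ≤ W
  mem : ∀ a, s.mem a ≤ W

variable (I)

/-- `Runs I W A p t μ Q ρ m`: started with registers `ρ` and memory `m`, the program `p` ends within
`t` steps without exceeding the word bound `W` and the address bound `A`. The outcome of its random
draws determines a ghost value with distribution `μ`, and the ghost value `a`, the final registers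
and the final memory satisfy `Q a`. -/
def Runs (W A : ℕ) (p : Prog) (t : ℕ) (μ : PMF α) (Q : α → (ℕ → ℕ) → (ℕ → ℕ) → Prop)
    (ρ m : ℕ → ℕ) : Prop :=
  ∀ s : State, s.reg = ρ → s.mem = m → s.Within W A → ∃ ν : PMF (α × State),
    ν.map Prod.fst = μ ∧ Exec I p s t ν ∧
      ∀ x ∈ ν.support, x.2.Within W A ∧ Q x.1 x.2.reg x.2.mem

variable {I}
variable {W A : ℕ} {ρ m : ℕ → ℕ}

theorem Runs.mono {p : Prog} {t t' : ℕ} {μ : PMF α} {Q Q' : α → (ℕ → ℕ) → (ℕ → ℕ) → Prop}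
    (h : Runs I W A p t μ Q ρ m) (ht : t ≤ t') (hQ : ∀ a ρ' m', Q a ρ' m' → Q' a ρ' m') :
    Runs I W A p t' μ Q' ρ m := by
  intro s h₁ h₂ h₃
  obtain ⟨ν, h₄, h₅, h₆⟩ := h s h₁ h₂ h₃
  exact ⟨ν, h₄, h₅.mono ht, fun x hx => ⟨(h₆ x hx).1, hQ _ _ _ (h₆ x hx).2⟩⟩

/-- The rule behind sequential composition and unrolling of loops. -/
theorem Runs.pair {P p q : Prog} {t₁ t₂ : ℕ} {μ : PMF α} {κ : α → PMF β}
    {Q : α → (ℕ → ℕ) → (ℕ → ℕ) → Prop} {R : β → (ℕ → ℕ) → (ℕ → ℕ) → Prop}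
    (h : ∀ (s : State) K, s.reg = ρ → step I (P :: K, s) = PMF.pure (p :: q :: K, s))
    (h₁ : Runs I W A p t₁ μ Q ρ m)
    (h₂ : ∀ a ρ' m', Q a ρ' m' → Runs I W A q t₂ (κ a) R ρ' m') :
    Runs I W A P (1 + t₁ + t₂) (μ.bind κ) R ρ m := by
  intro s hs₁ hs₂ hs₃
  obtain ⟨ν, hν₁, hν₂, hν₃⟩ := h₁ s hs₁ hs₂ hs₃
  have : ∀ x : α × State, ∃ ν' : PMF (β × State), ν'.map Prod.fst = κ x.1 ∧
      (x ∈ ν.support → Exec I q x.2 t₂ ν' ∧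
        ∀ y ∈ ν'.support, y.2.Within W A ∧ R y.1 y.2.reg y.2.mem) := by
    intro x
    by_cases hx : x ∈ ν.support
    · obtain ⟨ν', h₁, h₂, h₃⟩ := h₂ _ _ _ (hν₃ x hx).2 x.2 rfl rfl (hν₃ x hx).1
      exact ⟨ν', h₁, fun _ => ⟨h₂, h₃⟩⟩
    · refine ⟨(κ x.1).map fun b => (b, x.2), ?_, fun h => absurd h hx⟩
      rw [PMF.map_comp]
      exact PMF.map_id _
  choose ν' h₁' h₂' using this
  refine ⟨ν.bind ν', ?_, Exec.pair (fun K => h s K hs₁) hν₂ fun x hx => (h₂' x hx).1, ?_⟩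
  · rw [PMF.map_bind, ← hν₁, PMF.bind_map]
    exact congrArg _ (funext h₁')
  · intro y hy
    obtain ⟨x, hx, hy⟩ := (PMF.mem_support_bind_iff _ _ _).1 hy
    exact (h₂' x hx).2 y hy

theorem Runs.seq {p q : Prog} {t₁ t₂ : ℕ} {μ : PMF α} {κ : α → PMF β}
    {Q : α → (ℕ → ℕ) → (ℕ → ℕ) → Prop} {R : β → (ℕ → ℕ) → (ℕ → ℕ) → Prop}
    (h₁ : Runs I W A p t₁ μ Q ρ m)
    (h₂ : ∀ a ρ' m', Q a ρ' m' → Runs I W A q t₂ (κ a) R ρ' m') :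
    Runs I W A (.seq p q) (1 + t₁ + t₂) (μ.bind κ) R ρ m :=
  Runs.pair (fun _ _ _ => rfl) h₁ h₂

theorem Runs.pure_eq {p : Prog} {t : ℕ} {a : α} {Q : α → (ℕ → ℕ) → (ℕ → ℕ) → Prop}
    (h : Runs I W A p t (PMF.pure a) Q ρ m) :
    Runs I W A p t (PMF.pure a) (fun b ρ' m' => b = a ∧ Q b ρ' m') ρ m := by
  intro s hs₁ hs₂ hs₃
  obtain ⟨ν, hν₁, hν₂, hν₃⟩ := h s hs₁ hs₂ hs₃
  refine ⟨ν, hν₁, hν₂, fun x hx => ⟨(hν₃ x hx).1, ?_, (hν₃ x hx).2⟩⟩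
  rw [← PMF.mem_support_pure_iff, ← hν₁]
  exact (PMF.mem_support_map_iff _ _ _).2 ⟨x, hx, rfl⟩

/-- Sequential composition after a program whose ghost value is deterministic. -/
theorem Runs.seq_pure {p q : Prog} {t₁ t₂ : ℕ} {a : α} {μ : PMF β}
    {Q : α → (ℕ → ℕ) → (ℕ → ℕ) → Prop} {R : β → (ℕ → ℕ) → (ℕ → ℕ) → Prop}
    (h₁ : Runs I W A p t₁ (PMF.pure a) Q ρ m)
    (h₂ : ∀ ρ' m', Q a ρ' m' → Runs I W A q t₂ μ R ρ' m') :
    Runs I W A (.seq p q) (1 + t₁ + t₂) μ R ρ m := by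
  have := Runs.seq (κ := fun _ => μ) h₁.pure_eq (t₂ := t₂) (q := q) (R := R) fun b ρ' m' h => by
    obtain ⟨rfl, h⟩ := h
    exact h₂ ρ' m' h
  rwa [PMF.pure_bind] at this

/-- Sequential composition with a program that leaves the ghost value alone. -/
theorem Runs.seq_ret {p q : Prog} {t₁ t₂ : ℕ} {μ : PMF α}
    {Q R : α → (ℕ → ℕ) → (ℕ → ℕ) → Prop}
    (h₁ : Runs I W A p t₁ μ Q ρ m)
    (h₂ : ∀ a ρ' m', Q a ρ' m' → Runs I W A q t₂ (PMF.pure a) R ρ' m') :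
    Runs I W A (.seq p q) (1 + t₁ + t₂) μ R ρ m := by
  have := Runs.seq h₁ h₂
  rwa [PMF.bind_pure] at this

/-- Deterministic programs may carry along any ghost value. -/
theorem Runs.ghost {p : Prog} {t : ℕ} {a : α} {b : β} {Q : α → (ℕ → ℕ) → (ℕ → ℕ) → Prop}
    (h : Runs I W A p t (PMF.pure a) Q ρ m) :
    Runs I W A p t (PMF.pure b) (fun _ => Q a) ρ m := by
  intro s hs₁ hs₂ hs₃
  obtain ⟨ν, hν₁, hν₂, hν₃⟩ := h s hs₁ hs₂ hs₃
  refine ⟨ν.map fun x => (b, x.2), ?_, ?_, ?_⟩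
  · rw [PMF.map_comp]
    exact PMF.map_const _ b
  · intro K T hT
    rw [PMF.bind_map]
    exact hν₂ K T fun x hx => hT (b, x.2) ((PMF.mem_support_map_iff _ _ _).2 ⟨x, hx, rfl⟩)
  · intro y hy
    obtain ⟨x, hx, rfl⟩ := (PMF.mem_support_map_iff _ _ _).1 hy
    refine ⟨(hν₃ x hx).1, ?_⟩
    have : x.1 = a := by
      rw [← PMF.mem_support_pure_iff, ← hν₁]
      exact (PMF.mem_support_map_iff _ _ _).2 ⟨x, hx, rfl⟩
    exact this ▸ (hν₃ x hx).2

theorem Runs.atom_pure {p : Prog} {a : α} {Q : α → (ℕ → ℕ) → (ℕ → ℕ) → Prop} (f : State → State)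
    (h : ∀ (s : State) K, s.reg = ρ → step I (p :: K, s) = PMF.pure (K, f s))
    (hf : ∀ s : State, s.reg = ρ → s.mem = m → s.Within W A →
      (f s).Within W A ∧ Q a (f s).reg (f s).mem) :
    Runs I W A p 1 (PMF.pure a) Q ρ m := by
  intro s hs₁ hs₂ hs₃
  refine ⟨PMF.pure (a, f s), PMF.pure_map _ _, Exec.atom fun K => ?_, ?_⟩
  · rw [h s K hs₁, PMF.pure_map]
  · intro x hx
    rw [PMF.mem_support_pure_iff] at hx
    subst hx
    exact hf s hs₁ hs₂ hs₃

theorem Runs.loop_done {r : ℕ} {p : Prog} {a : α} {Q : α → (ℕ → ℕ) → (ℕ → ℕ) → Prop}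
    (hr : ρ r = 0) (hQ : Q a ρ m) : Runs I W A (.loop r p) 1 (PMF.pure a) Q ρ m :=
  Runs.atom_pure id (fun s K hs => by simp [step, hs, hr]) fun s hs₁ hs₂ hs₃ =>
    ⟨hs₃, by rw [id, hs₁, hs₂]; exact hQ⟩

theorem Runs.loop_step {r : ℕ} {p : Prog} {t₁ t₂ : ℕ} {μ : PMF α} {κ : α → PMF β}
    {Q : α → (ℕ → ℕ) → (ℕ → ℕ) → Prop} {R : β → (ℕ → ℕ) → (ℕ → ℕ) → Prop}
    (hr : ρ r ≠ 0) (h₁ : Runs I W A p t₁ μ Q ρ m)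
    (h₂ : ∀ a ρ' m', Q a ρ' m' → Runs I W A (.loop r p) t₂ (κ a) R ρ' m') :
    Runs I W A (.loop r p) (1 + t₁ + t₂) (μ.bind κ) R ρ m :=
  Runs.pair (fun s K hs => by simp [step, hs, hr]) h₁ h₂

theorem Runs.cond {r : ℕ} {p q : Prog} {t : ℕ} {μ : PMF α} {Q : α → (ℕ → ℕ) → (ℕ → ℕ) → Prop}
    (h₁ : ρ r ≠ 0 → Runs I W A p t μ Q ρ m) (h₂ : ρ r = 0 → Runs I W A q t μ Q ρ m) :
    Runs I W A (.cond r p q) (1 + t) μ Q ρ m := by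
  intro s hs₁ hs₂ hs₃
  by_cases hr : ρ r = 0
  · obtain ⟨ν, hν₁, hν₂, hν₃⟩ := h₂ hr s hs₁ hs₂ hs₃
    exact ⟨ν, hν₁, Exec.single (fun K => by simp [step, hs₁, hr]) hν₂, hν₃⟩
  · obtain ⟨ν, hν₁, hν₂, hν₃⟩ := h₁ hr s hs₁ hs₂ hs₃
    exact ⟨ν, hν₁, Exec.single (fun K => by simp [step, hs₁, hr]) hν₂, hν₃⟩

theorem State.Within.setReg {s : State} (hs : s.Within W A) {r x : ℕ} (hx : x ≤ W) :
    (s.setReg r x).Within W A where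
  maxWord := max_le hs.maxWord hx
  memTop := hs.memTop
  reg i := by
    simp only [State.setReg, Function.update_apply]
    split_ifs
    exacts [hx, hs.reg i]
  mem := hs.mem

theorem State.Within.touch {s : State} (hs : s.Within W A) {a : ℕ} (ha : a < A) :
    (s.touch a).Within W A where
  maxWord := hs.maxWord
  memTop := max_le hs.memTop ha
  reg := hs.reg
  mem := hs.mem

theorem State.Within.setMem {s : State} (hs : s.Within W A) {a x : ℕ} (ha : a < A) (hx : x ≤ W) :
    (s.setMem a x).Within W A where
  maxWord := hs.maxWord
  memTop := max_le hs.memTop ha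
  reg := hs.reg
  mem i := by
    simp only [State.setMem, Function.update_apply]
    split_ifs
    exacts [hx, hs.mem i]

theorem State.Within.countQuery {s : State} (hs : s.Within W A) : s.countQuery.Within W A :=
  ⟨hs.maxWord, hs.memTop, hs.reg, hs.mem⟩

theorem IncidenceList.degreeQuery_le (v : ℕ) : I.degreeQuery v ≤ n := by
  unfold IncidenceList.degreeQuery
  split_ifs with h
  · simpa using (I.nodup ⟨v, h⟩).length_le_card
  · exact Nat.zero_le _

theorem IncidenceList.neighborQuery_le (v i : ℕ) : I.neighborQuery v i ≤ n := by
  unfold IncidenceList.neighborQuery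
  split_ifs with h h'
  · exact (Fin.is_lt _).le
  · exact le_rfl
  · exact le_rfl

/-- The draw of a random element of `{0, …, ρ a - 1}`; the drawn element is the ghost value. -/
theorem Runs.rand {r a : ℕ} {Q : ℕ → (ℕ → ℕ) → (ℕ → ℕ) → Prop} (ha : 0 < ρ a)
    (hQ : ∀ x < ρ a, Q x (Function.update ρ r x) m) :
    Runs I W A (.rand r a) 1 (uniformBelow (ρ a)) Q ρ m := by
  intro s hs₁ hs₂ hs₃
  refine ⟨(uniformBelow (ρ a)).map fun x => (x, s.setReg r x), ?_, Exec.atom fun K => ?_, ?_⟩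
  · rw [PMF.map_comp]
    exact PMF.map_id _
  · rw [PMF.map_comp, step, hs₁]
    rfl
  · intro y hy
    obtain ⟨x, hx, rfl⟩ := (PMF.mem_support_map_iff _ _ _).1 hy
    have hx : x < ρ a := by
      rw [uniformBelow, dif_pos ha] at hx
      exact Finset.mem_range.1 ((PMF.mem_support_uniformOfFinset_iff _ _).1 hx)
    refine ⟨hs₃.setReg (hx.le.trans (hs₁ ▸ hs₃.reg a)), ?_⟩
    have := hQ x hx
    rw [← hs₁, ← hs₂] at this
    exact this

variable (I W A) in
/-- Weakest preconditions of programs without loops and random draws. Only additions,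
multiplications and literals can produce a word that is larger than all words before. -/
def wp : Prog → ((ℕ → ℕ) → (ℕ → ℕ) → Prop) → (ℕ → ℕ) → (ℕ → ℕ) → Prop
  | .skip, Q, ρ, m => Q ρ m
  | .const r k, Q, ρ, m => k ≤ W ∧ Q (Function.update ρ r k) m
  | .op .add r a b, Q, ρ, m => ρ a + ρ b ≤ W ∧ Q (Function.update ρ r (ρ a + ρ b)) m
  | .op .mul r a b, Q, ρ, m => ρ a * ρ b ≤ W ∧ Q (Function.update ρ r (ρ a * ρ b)) m
  | .op o r a b, Q, ρ, m => Q (Function.update ρ r (o.eval (ρ a) (ρ b))) m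
  | .load r a, Q, ρ, m => ρ a < A ∧ Q (Function.update ρ r (m (ρ a))) m
  | .store a b, Q, ρ, m => ρ a < A ∧ Q ρ (Function.update m (ρ a) (ρ b))
  | .degree r v, Q, ρ, m => Q (Function.update ρ r (I.degreeQuery (ρ v))) m
  | .neighbor r v i, Q, ρ, m => Q (Function.update ρ r (I.neighborQuery (ρ v) (ρ i))) m
  | .seq p q, Q, ρ, m => wp p (wp q Q) ρ m
  | .cond r p q, Q, ρ, m => (ρ r ≠ 0 → wp p Q ρ m) ∧ (ρ r = 0 → wp q Q ρ m)
  | .rand _ _, _, _, _ => False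
  | .loop _ _, _, _, _ => False

/-- An upper bound for the number of steps of a program without loops. -/
def Prog.cost : Prog → ℕ
  | .seq p q => 1 + p.cost + q.cost
  | .cond _ p q => 1 + max p.cost q.cost
  | _ => 1

theorem Op.eval_le {o : Op} (h₁ : o ≠ .add) (h₂ : o ≠ .mul) {a b W : ℕ} (hW : 1 ≤ W)
    (ha : a ≤ W) : o.eval a b ≤ W := by
  cases o <;> simp only [Op.eval] <;> try contradiction
  · omega
  · exact (Nat.div_le_self _ _).trans ha
  · exact (Nat.mod_le _ _).trans ha
  all_goals split_ifs <;> omega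

/-- Since the steps of such a program are deterministic, any ghost value will do. -/
theorem Runs.of_wp {p : Prog} {a : α} {Q : (ℕ → ℕ) → (ℕ → ℕ) → Prop} (hW : 1 ≤ W) (hn : n ≤ W)
    (h : wp I W A p Q ρ m) : Runs I W A p p.cost (PMF.pure a) (fun _ => Q) ρ m := by
  induction p generalizing ρ m Q with
  | skip =>
    refine Runs.atom_pure id (fun _ _ _ => rfl) fun s hs₁ hs₂ hs₃ => ?_
    subst hs₁ hs₂
    exact ⟨hs₃, h⟩
  | const r k =>
    refine Runs.atom_pure (fun s => s.setReg r k) (fun _ _ _ => rfl) fun s hs₁ hs₂ hs₃ => ?_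
    subst hs₁ hs₂
    exact ⟨hs₃.setReg h.1, h.2⟩
  | op o r a b =>
    refine Runs.atom_pure (fun s => s.setReg r (o.eval (s.reg a) (s.reg b))) (fun _ _ _ => rfl)
      fun s hs₁ hs₂ hs₃ => ?_
    subst hs₁ hs₂
    cases o
    case add => exact ⟨hs₃.setReg h.1, h.2⟩
    case mul => exact ⟨hs₃.setReg h.1, h.2⟩
    all_goals exact ⟨hs₃.setReg (Op.eval_le (by simp) (by simp) hW (hs₃.reg a)), h⟩
  | load r a =>
    refine Runs.atom_pure (fun s => (s.touch (s.reg a)).setReg r (s.mem (s.reg a)))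
      (fun _ _ _ => rfl) fun s hs₁ hs₂ hs₃ => ?_
    subst hs₁ hs₂
    exact ⟨(hs₃.touch h.1).setReg (hs₃.mem _), h.2⟩
  | store a b =>
    refine Runs.atom_pure (fun s => s.setMem (s.reg a) (s.reg b)) (fun _ _ _ => rfl)
      fun s hs₁ hs₂ hs₃ => ?_
    subst hs₁ hs₂
    exact ⟨hs₃.setMem h.1 (hs₃.reg _), h.2⟩
  | rand r a => exact h.elim
  | degree r v =>
    refine Runs.atom_pure (fun s => s.countQuery.setReg r (I.degreeQuery (s.reg v)))
      (fun _ _ _ => rfl) fun s hs₁ hs₂ hs₃ => ?_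
    subst hs₁ hs₂
    exact ⟨hs₃.countQuery.setReg ((I.degreeQuery_le _).trans hn), h⟩
  | neighbor r v i =>
    refine Runs.atom_pure
      (fun s => s.countQuery.setReg r (I.neighborQuery (s.reg v) (s.reg i)))
      (fun _ _ _ => rfl) fun s hs₁ hs₂ hs₃ => ?_
    subst hs₁ hs₂
    exact ⟨hs₃.countQuery.setReg ((I.neighborQuery_le _ _).trans hn), h⟩
  | seq p q ihp ihq => exact Runs.seq_pure (ihp h) fun ρ' m' h' => ihq h'
  | cond r p q ihp ihq =>
    exact Runs.cond (fun hr => (ihp (h.1 hr)).mono (le_max_left _ _) fun _ _ _ => id)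
      fun hr => (ihq (h.2 hr)).mono (le_max_right _ _) fun _ _ _ => id
  | loop r p => exact h.elim

theorem Runs.straight {p : Prog} {t : ℕ} {a : α} {Q : α → (ℕ → ℕ) → (ℕ → ℕ) → Prop}
    (hW : 1 ≤ W) (hn : n ≤ W) (ht : p.cost ≤ t) (h : wp I W A p (Q a) ρ m) :
    Runs I W A p t (PMF.pure a) Q ρ m :=
  (Runs.of_wp hW hn h).pure_eq.mono ht fun _ _ _ h => h.1 ▸ h.2

/-! ### Counting loops -/

/-- `for i = 0, …, N - 1 do body`, where `i`, `N` and `tmp` are register numbers. The body must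
preserve the registers `i` and `N`. -/
def forLoop (i N tmp : ℕ) (body : Prog) : Prog :=
  .seq (.const i 0) (.seq (.op .lt tmp i N)
    (.loop tmp (.seq body (.seq (.const tmp 1) (.seq (.op .add i i tmp) (.op .lt tmp i N))))))

/-- The composition of the random transitions `κ i`, `κ (i + 1)`, …, `κ (i + N - 1)`. -/
noncomputable def iterate (κ : ℕ → α → PMF α) : ℕ → ℕ → α → PMF α
  | _, 0, a => PMF.pure a
  | i, N + 1, a => (κ i a).bind (iterate κ (i + 1) N)

theorem iterate_pure {N : ℕ} (i : ℕ) (a : α) : iterate (fun _ => PMF.pure) i N a = PMF.pure a := by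
  induction N generalizing i with
  | zero => rfl
  | succ N ih => rw [iterate, PMF.pure_bind, ih]

/-- The rule for counting loops: round `j` takes at most `τ j` steps for the body and `8` for the
control, and it applies the transition `κ j` to the ghost value. The hypothesis `stable` says that
the invariant does not depend on the registers `i` and `tmp`, which the loop itself writes. -/
theorem Runs.forLoop {i N tmp M : ℕ} {body : Prog} {κ : ℕ → α → PMF α} {τ : ℕ → ℕ} {a : α}
    {Inv : ℕ → α → (ℕ → ℕ) → (ℕ → ℕ) → Prop} (hiN : i ≠ N) (hit : i ≠ tmp) (hNt : N ≠ tmp)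
    (hMW : M < W) (hn : n ≤ W) (hM : ρ N = M)
    (stable : ∀ j a ρ m x y, Inv j a ρ m →
      Inv j a (Function.update (Function.update ρ i x) tmp y) m)
    (hbody : ∀ j < M, ∀ a ρ m, ρ i = j → ρ N = M → Inv j a ρ m →
      Runs I W A body (τ j) (κ j a)
        (fun a' ρ' m' => ρ' i = j ∧ ρ' N = M ∧ Inv (j + 1) a' ρ' m') ρ m)
    (hinit : Inv 0 a ρ m) :
    Runs I W A (forLoop i N tmp body) (∑ j ∈ Finset.range M, (τ j + 8) + 6) (iterate κ 0 M a)
      (fun a' ρ' m' => ρ' N = M ∧ Inv M a' ρ' m') ρ m := by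
  -- `R` is the number of rounds that remain.
  have main : ∀ R j, j + R = M → ∀ a ρ m, ρ i = j → ρ N = M →
      ρ tmp = (if j < M then 1 else 0) → Inv j a ρ m →
      Runs I W A (.loop tmp (.seq body (.seq (.const tmp 1) (.seq (.op .add i i tmp)
        (.op .lt tmp i N))))) (∑ k ∈ Finset.Ico j M, (τ k + 8) + 1) (iterate κ j R a)
        (fun a' ρ' m' => ρ' N = M ∧ Inv M a' ρ' m') ρ m := by
    intro R
    induction R with
    | zero =>
      intro j hj a ρ m h₁ h₂ h₃ h₄
      obtain rfl : j = M := by omega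
      simp only [Finset.Ico_self, Finset.sum_empty, Nat.zero_add]
      exact Runs.loop_done (by simpa using h₃) ⟨h₂, h₄⟩
    | succ R ih =>
      intro j hj a ρ m h₁ h₂ h₃ h₄
      have hjM : j < M := by omega
      rw [Finset.sum_eq_sum_Ico_succ_bot hjM]
      refine (Runs.loop_step (t₁ := τ j + 7) (t₂ := ∑ k ∈ Finset.Ico (j + 1) M, (τ k + 8) + 1)
        (Q := fun a' ρ' m' => ρ' i = j + 1 ∧ ρ' N = M ∧
          ρ' tmp = (if j + 1 < M then 1 else 0) ∧ Inv (j + 1) a' ρ' m')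
        (R := fun a' ρ' m' => ρ' N = M ∧ Inv M a' ρ' m')
        (by simp [h₃, hjM]) ?_ ?_).mono ?_ ?_
      · refine (Runs.seq_ret (t₂ := 5) (hbody j hjM a ρ m h₁ h₂ h₄) fun a' ρ' m' h =>
          Runs.straight (by omega) hn (by simp [Prog.cost]) ?_).mono (by omega) fun _ _ _ h => h
        · obtain ⟨h₁, h₂, h₃⟩ := h
          have := stable _ _ _ _ (j + 1) (if j + 1 < M then 1 else 0) h₃
          refine ⟨by omega, ?_, ?_, ?_, ?_, ?_⟩
          · simp [hit, h₁]; omega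
          · simp [hit, h₁]
          · simp [Function.update_apply, hNt, hiN.symm, h₂]
          · simp [hit, hNt, hiN.symm, h₁, h₂, Op.eval]
          · convert this using 1
            funext r
            simp only [Function.update_apply, Op.eval, h₁, h₂]
            split_ifs <;> simp_all
      · rintro a' ρ' m' ⟨h₁, h₂, h₃, h₄⟩
        exact ih (j + 1) (by omega) a' ρ' m' h₁ h₂ h₃ h₄
      · omega
      · exact fun a' ρ' m' h => h
  have h₁ : Runs I W A (.const i 0) 1 (PMF.pure ())
      (fun _ ρ' m' => ρ' = Function.update ρ i 0 ∧ m' = m) ρ m :=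
    Runs.of_wp (p := .const i 0) (by omega) hn (by simp [wp])
  refine (h₁.seq_pure (t₂ := ∑ j ∈ Finset.range M, (τ j + 8) + 3) ?_).mono (by omega)
    fun _ _ _ h => h
  rintro ρ₁ m₁ ⟨hρ₁, hm₁⟩
  have h₂ : Runs I W A (.op .lt tmp i N) 1 (PMF.pure ())
      (fun _ ρ' m' => ρ' = Function.update (Function.update ρ i 0) tmp (if 0 < M then 1 else 0) ∧
        m' = m) ρ₁ m₁ :=
    Runs.of_wp (p := .op .lt tmp i N) (by omega) hn
      (by simp [wp, hρ₁, hm₁, Op.eval, hiN.symm, hM])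
  refine (h₂.seq_pure (t₂ := ∑ j ∈ Finset.range M, (τ j + 8) + 1) ?_).mono (by omega)
    fun _ _ _ h => h
  rintro ρ₂ m₂ ⟨rfl, rfl⟩
  rw [← Nat.Ico_zero_eq_range]
  refine main M 0 (by omega) _ _ _ ?_ ?_ ?_ (stable _ _ _ _ _ _ hinit)
  · simp [hit]
  · simp [hNt, hiN.symm, hM]
  · simp

/-- A counting loop without random draws. -/
theorem Runs.forLoop_pure {i N tmp M : ℕ} {body : Prog} {τ : ℕ} {a : α}
    {Inv : ℕ → (ℕ → ℕ) → (ℕ → ℕ) → Prop} (hiN : i ≠ N) (hit : i ≠ tmp) (hNt : N ≠ tmp)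
    (hMW : M < W) (hn : n ≤ W) (hM : ρ N = M)
    (stable : ∀ j ρ m x y, Inv j ρ m →
      Inv j (Function.update (Function.update ρ i x) tmp y) m)
    (hbody : ∀ j < M, ∀ ρ m, ρ i = j → ρ N = M → Inv j ρ m →
      Runs I W A body τ (PMF.pure ())
        (fun _ ρ' m' => ρ' i = j ∧ ρ' N = M ∧ Inv (j + 1) ρ' m') ρ m)
    (hinit : Inv 0 ρ m) :
    Runs I W A (DensestSubgraph.forLoop i N tmp body) (M * (τ + 8) + 6) (PMF.pure a)
      (fun _ ρ' m' => ρ' N = M ∧ Inv M ρ' m') ρ m := by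
  have := Runs.forLoop (I := I) (A := A) (κ := fun _ => PMF.pure) (τ := fun _ => τ) (a := ())
    (body := body) (Inv := fun j _ => Inv j) hiN hit hNt hMW hn hM (fun j _ => stable j)
    (fun j hj _ => hbody j hj) hinit
  rw [iterate_pure, Finset.sum_const, Finset.card_range, smul_eq_mul] at this
  exact this.ghost

end Machine

/-! ### Samples of edges and the peeling process -/

/-- The indicator function of a finite set of numbers. -/
def ind (S : Finset ℕ) (v : ℕ) : ℕ := if v ∈ S then 1 else 0

theorem ind_le (S : Finset ℕ) (v : ℕ) : ind S v ≤ 1 := by unfold ind; split_ifs <;> simp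

theorem ind_eq_zero {S : Finset ℕ} {v : ℕ} (h : v ∉ S) : ind S v = 0 := if_neg h

theorem ind_eq_one {S : Finset ℕ} {v : ℕ} (h : v ∈ S) : ind S v = 1 := if_pos h

/-- The number `v * (n + 1) + u` codes the pair `(v, u)` of numbers `≤ n`. The value is `1` if both
components of the pair coded by `c` belong to `S`, and `0` otherwise. -/
def inside (n : ℕ) (S : Finset ℕ) (c : ℕ) : ℕ := ind S (c / (n + 1)) * ind S (c % (n + 1))

theorem inside_le (n : ℕ) (S : Finset ℕ) (c : ℕ) : inside n S c ≤ 1 :=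
  Nat.mul_le_mul (ind_le _ _) (ind_le _ _)

/-- The number of pairs in the list `l` that lie inside `S`. -/
def edgeCount (n : ℕ) (l : List ℕ) (S : Finset ℕ) : ℕ := (l.map (inside n S)).sum

/-- How often `v` occurs as a component of the pair coded by `c`. -/
def incidence (n v c : ℕ) : ℕ :=
  (if v = c / (n + 1) then 1 else 0) + (if v = c % (n + 1) then 1 else 0)

/-- The degree of `v` in the multigraph on `S` whose edges are the pairs in `l` inside `S`. -/
def degIn (n : ℕ) (l : List ℕ) (S : Finset ℕ) (v : ℕ) : ℕ :=
  (l.map fun c => inside n S c * incidence n v c).sum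

/-- One round of peeling: the nodes whose degree is at most `2 (1 + 1 / K)` times the density are
removed. -/
def peel (n K : ℕ) (l : List ℕ) (S : Finset ℕ) : Finset ℕ :=
  S.filter fun v => 2 * ((K + 1) * edgeCount n l S) < degIn n l S v * (S.card * K)

/-- The set of nodes that survive the first `i` rounds of peeling. -/
def survivors (n K : ℕ) (l : List ℕ) : ℕ → Finset ℕ
  | 0 => Finset.range n
  | i + 1 => peel n K l (survivors n K l i)

theorem survivors_subset (n K : ℕ) (l : List ℕ) (i : ℕ) :
    survivors n K l i ⊆ Finset.range n := by
  induction i with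
  | zero => exact subset_rfl
  | succ i ih => exact (Finset.filter_subset _ _).trans ih

theorem edgeCount_le_length (n : ℕ) (l : List ℕ) (S : Finset ℕ) : edgeCount n l S ≤ l.length := by
  induction l with
  | nil => simp [edgeCount]
  | cons c l ih =>
    have := inside_le n S c
    simp only [edgeCount, List.map_cons, List.sum_cons, List.length_cons] at ih ⊢
    omega

theorem incidence_le (n v c : ℕ) : incidence n v c ≤ 2 := by
  unfold incidence; split_ifs <;> simp

theorem degIn_le_length (n : ℕ) (l : List ℕ) (S : Finset ℕ) (v : ℕ) :
    degIn n l S v ≤ 2 * l.length := by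
  induction l with
  | nil => simp [degIn]
  | cons c l ih =>
    have := Nat.mul_le_mul (inside_le n S c) (incidence_le n v c)
    simp only [degIn, List.map_cons, List.sum_cons, List.length_cons] at ih ⊢
    omega

/-! ### Layout of the memory -/

/-- The contents of the memory: the output vector `o` in the cells `0, …, n - 1`, the vector `a` of
surviving nodes in the cells `n, …, 2 n`, the degrees `d` in the cells `2 n + 1, …, 3 n + 1`, and
from the cell `3 n + 2` on the list `l` of sampled edges. The vectors `a` and `d` have an entry for
the number `n`, which stands for a missing neighbor. -/
def layout (n : ℕ) (o a d : ℕ → ℕ) (l : List ℕ) (x : ℕ) : ℕ :=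
  if x < n then o x else if x ≤ 2 * n then a (x - n) else
    if x ≤ 3 * n + 1 then d (x - (2 * n + 1)) else l.getD (x - (3 * n + 2)) 0

section Layout

variable {n : ℕ} {o a d o' a' d' : ℕ → ℕ} {l : List ℕ} {v x : ℕ}

theorem layout_out (h : v < n) : layout n o a d l v = o v := if_pos h

theorem layout_alive (h : v ≤ n) : layout n o a d l (n + v) = a v := by
  rw [layout, if_neg (by omega), if_pos (by omega), Nat.add_sub_cancel_left]

theorem layout_deg (h : v ≤ n) : layout n o a d l (2 * n + 1 + v) = d v := by
  rw [layout, if_neg (by omega), if_neg (by omega), if_pos (by omega), Nat.add_sub_cancel_left]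

theorem layout_edge : layout n o a d l (3 * n + 2 + v) = l.getD v 0 := by
  rw [layout, if_neg (by omega), if_neg (by omega), if_neg (by omega), Nat.add_sub_cancel_left]

theorem update_layout_out (h : v < n) :
    Function.update (layout n o a d l) v x = layout n (Function.update o v x) a d l := by
  funext y
  simp only [Function.update_apply, layout]
  split_ifs <;> first | rfl | omega

theorem update_layout_alive (h : v ≤ n) :
    Function.update (layout n o a d l) (n + v) x = layout n o (Function.update a v x) d l := by
  funext y
  simp only [Function.update_apply, layout]
  split_ifs <;> first | rfl | omega

theorem update_layout_deg (h : v ≤ n) :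
    Function.update (layout n o a d l) (2 * n + 1 + v) x =
      layout n o a (Function.update d v x) l := by
  funext y
  simp only [Function.update_apply, layout]
  split_ifs <;> first | rfl | omega

theorem update_layout_edge :
    Function.update (layout n o a d l) (3 * n + 2 + l.length) x = layout n o a d (l ++ [x]) := by
  funext y
  simp only [Function.update_apply, layout]
  split_ifs with h₁ h₂ h₃ h₄ h₂ h₃ h₄ <;> first | rfl | omega | skip
  · simp [h₁]
  · rcases lt_or_ge (y - (3 * n + 2)) l.length with h | h
    · simp [List.getD_eq_getElem?_getD, List.getElem?_append_left h]
    · simp only [List.getD_eq_getElem?_getD]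
      rw [List.getElem?_eq_none h, List.getElem?_eq_none (by simp; omega)]

theorem layout_congr (ho : ∀ v < n, o v = o' v) (ha : ∀ v ≤ n, a v = a' v)
    (hd : ∀ v ≤ n, d v = d' v) : layout n o a d l = layout n o' a' d' l := by
  funext y
  simp only [layout]
  split_ifs with h₁ h₂ h₃
  exacts [ho _ h₁, ha _ (by omega), hd _ (by omega), rfl]

end Layout

/-- The vector that a loop writing the entries of `f` over those of `g` has produced before its
`i`-th round. -/
def mix (i : ℕ) (f g : ℕ → ℕ) (v : ℕ) : ℕ := if v < i then f v else g v

theorem update_mix (i : ℕ) (f g : ℕ → ℕ) :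
    Function.update (mix i f g) i (f i) = mix (i + 1) f g := by
  funext v
  simp only [Function.update_apply, mix]
  split_ifs <;> first | rfl | omega | simp_all

theorem mix_of_lt {i v : ℕ} (f g : ℕ → ℕ) (h : v < i) : mix i f g v = f v := if_pos h

theorem mix_of_le {i v : ℕ} (f g : ℕ → ℕ) (h : i ≤ v) : mix i f g v = g v := if_neg h.not_gt

/-- The registers below `b` are those of `ρ₀`. -/
def Frame (b : ℕ) (ρ₀ ρ : ℕ → ℕ) : Prop := ∀ r < b, ρ r = ρ₀ r

theorem Frame.refl (b : ℕ) (ρ : ℕ → ℕ) : Frame b ρ ρ := fun _ _ => rfl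

theorem Frame.trans {b : ℕ} {ρ₀ ρ₁ ρ₂ : ℕ → ℕ} (h₁ : Frame b ρ₀ ρ₁) (h₂ : Frame b ρ₁ ρ₂) :
    Frame b ρ₀ ρ₂ := fun r hr => (h₂ r hr).trans (h₁ r hr)

theorem Frame.mono {b b' : ℕ} {ρ₀ ρ : ℕ → ℕ} (h : Frame b ρ₀ ρ) (hb : b' ≤ b) : Frame b' ρ₀ ρ :=
  fun r hr => h r (hr.trans_le hb)

theorem frame_update {b r x : ℕ} {ρ₀ ρ : ℕ → ℕ} (h : b ≤ r) :
    Frame b ρ₀ (Function.update ρ r x) ↔ Frame b ρ₀ ρ := by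
  refine forall₂_congr fun i hi => ?_
  rw [Function.update_of_ne (by omega)]

/-! ### The program: peeling -/

/-! Registers: `0` number `n` of nodes, `1` accuracy parameter `k`, `2` the number `Nat.size n`, `3`
sampling width `w`, `4` the number `K = 16 k`, `5` and `6` start of the degrees and of the edges in
memory, `7` number of edges in memory, `8` the number `n + 1`, `9` number of rounds of peeling, `10`
index of outer loops, `11` and `12` edge count and node count of the best set so far, `14` and `13`
those of the current set; registers from `15` on are used locally. -/

/-- Sequential composition of a list of programs. -/
def block : List Prog → Prog
  | [] => .skip
  | [p] => p
  | p :: q :: ps => .seq p (block (q :: ps))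

/-- Set all degrees to `0` and count the surviving nodes. -/
def resetProg : Prog :=
  .seq (.const 13 0) (forLoop 18 0 19 (block [.op .add 20 5 18, .const 21 0, .store 20 21,
    .op .add 20 0 18, .load 21 20, .op .add 13 13 21]))

/-- Compute the degrees and count the edges among the surviving nodes. -/
def countProg : Prog :=
  .seq (.const 14 0) (forLoop 18 7 19 (block [.op .add 20 6 18, .load 20 20, .op .div 21 20 8,
    .op .mod 22 20 8, .op .add 23 0 21, .load 23 23, .op .add 24 0 22, .load 24 24,
    .op .mul 23 23 24, .op .add 24 5 21, .load 25 24, .op .add 25 25 23, .store 24 25,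
    .op .add 24 5 22, .load 25 24, .op .add 25 25 23, .store 24 25, .op .add 14 14 23]))

/-- Make the set of surviving nodes the best set. -/
def copyProg : Prog :=
  .seq (block [.const 21 0, .op .add 11 14 21, .op .add 12 13 21])
    (forLoop 18 0 19 (block [.op .add 20 0 18, .load 20 20, .store 18 20]))

/-- Replace the best set by the set of surviving nodes if the latter is denser. -/
def improveProg : Prog :=
  .seq (block [.op .mul 20 14 12, .op .mul 21 11 13, .op .lt 20 21 20]) (.cond 20 copyProg .skip)

/-- Remove the surviving nodes of low degree. -/
def removeProg : Prog :=
  .seq (block [.const 20 1, .op .add 15 4 20, .op .mul 15 15 14, .op .add 15 15 15,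
      .op .mul 16 13 4])
    (forLoop 18 0 19 (block [.op .add 20 5 18, .load 20 20, .op .mul 20 20 16, .op .lt 20 15 20,
      .op .add 21 0 18, .load 22 21, .op .mul 22 22 20, .store 21 22]))

/-- One round of peeling. -/
def roundProg : Prog := block [resetProg, countProg, improveProg, removeProg]

section Peel

variable {n : ℕ} {G : SimpleGraph (Fin n)} {I : IncidenceList G} {W A B K : ℕ} {l : List ℕ}
variable {ρ : ℕ → ℕ}

/-- The bounds on the parameters under which the words of the peeling program are at most `W` and
its addresses are below `A`. -/
structure PeelBounds (n K : ℕ) (l : List ℕ) (B W A : ℕ) : Prop where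
  nodes : 3 * n + 2 + 2 * l.length ≤ B
  acc : K + 1 ≤ B
  word : B * B * B ≤ W
  addr : 3 * n + 2 + l.length ≤ A
  code : ∀ c ∈ l, c / (n + 1) ≤ n

theorem PeelBounds.le_word (h : PeelBounds n K l B W A) : B * B ≤ W ∧ B + B ≤ W := by
  have h₁ := h.nodes
  have h₂ := h.word
  have h₃ : B * B * 2 ≤ B * B * B := Nat.mul_le_mul_left _ (by omega)
  have h₄ : B * 2 ≤ B * B := Nat.mul_le_mul_left _ (by omega)
  omega

/-- The registers hold the parameters of the peeling program. -/
structure PeelRegs (n K : ℕ) (l : List ℕ) (ρ : ℕ → ℕ) : Prop where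
  r0 : ρ 0 = n
  r4 : ρ 4 = K
  r5 : ρ 5 = 2 * n + 1
  r6 : ρ 6 = 3 * n + 2
  r7 : ρ 7 = l.length
  r8 : ρ 8 = n + 1

theorem PeelRegs.frame {ρ' : ℕ → ℕ} {b : ℕ} (h : PeelRegs n K l ρ) (hb : 9 ≤ b)
    (h' : Frame b ρ ρ') : PeelRegs n K l ρ' where
  r0 := (h' 0 (by omega)).trans h.r0
  r4 := (h' 4 (by omega)).trans h.r4
  r5 := (h' 5 (by omega)).trans h.r5
  r6 := (h' 6 (by omega)).trans h.r6
  r7 := (h' 7 (by omega)).trans h.r7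
  r8 := (h' 8 (by omega)).trans h.r8

theorem sum_ind_range_le (S : Finset ℕ) (j : ℕ) : ∑ v ∈ Finset.range j, ind S v ≤ j := by
  simpa using Finset.sum_le_card_nsmul (Finset.range j) (ind S) 1 fun v _ => ind_le S v

theorem sum_ind_range {S : Finset ℕ} (h : S ⊆ Finset.range n) :
    ∑ v ∈ Finset.range n, ind S v = S.card := by
  simp only [ind, Finset.sum_ite_mem, Finset.inter_eq_right.2 h, Finset.sum_const, smul_eq_mul,
    mul_one]

theorem runs_resetProg (hb : PeelBounds n K l B W A) (hρ : PeelRegs n K l ρ) {o d : ℕ → ℕ}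
    {S : Finset ℕ} (hS : S ⊆ Finset.range n) (hd : d n = 0) :
    Runs I W A resetProg (n * 19 + 8) (PMF.pure ())
      (fun _ ρ' m' => Frame 13 ρ ρ' ∧ ρ' 13 = S.card ∧
        ∃ d', (∀ v ≤ n, d' v = 0) ∧ m' = layout n o (ind S) d' l)
      ρ (layout n o (ind S) d l) := by
  have h₁ := hb.nodes
  have h₂ := hb.le_word
  have h₃ := hb.addr
  have key : Runs I W A (.const 13 0) 1 (PMF.pure ()) (fun _ ρ' m' => Frame 13 ρ ρ' ∧ ρ' 13 = 0 ∧
      m' = layout n o (ind S) d l) ρ (layout n o (ind S) d l) :=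
    Runs.straight (by omega) (by omega) le_rfl (by simp [wp, frame_update, Frame.refl])
  refine (key.seq_pure (t₂ := n * 19 + 6) fun ρ₁ m₁ hρ₁ => ?_).mono (by omega) fun _ _ _ h => h
  refine (Runs.forLoop_pure (τ := 11) (Inv := fun j ρ' m' => Frame 13 ρ ρ' ∧
    ρ' 13 = ∑ v ∈ Finset.range j, ind S v ∧ m' = layout n o (ind S) (mix j 0 d) l)
    (by decide) (by decide) (by decide) (by omega) (by omega) (hρ.frame (by omega) hρ₁.1).r0
    ?_ ?_ ?_).mono le_rfl ?_
  · intro j ρ' m' x y h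
    simpa [frame_update] using h
  · rintro j hj ρ' m' h18 h0 ⟨hF, h13, rfl⟩
    have hρ' := hρ.frame (by omega) hF
    have := ind_le S j
    have := sum_ind_range_le S j
    refine Runs.straight (by omega) (by omega) (by simp [block, Prog.cost]) ?_
    simp [block, wp, h18, hρ'.r5, hρ'.r0, h13, update_layout_deg hj.le,
      layout_alive hj.le, frame_update, hF, Finset.sum_range_succ]
    refine ⟨by omega, by omega, by omega, by omega, by omega, ?_⟩
    rw [← update_mix]
    rfl
  · exact ⟨hρ₁.1, by simpa using hρ₁.2.1, hρ₁.2.2⟩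
  · rintro - ρ' m' ⟨-, h₁, h₂, h₃⟩
    refine ⟨h₁, h₂.trans (sum_ind_range hS), mix n 0 d, fun v hv => ?_, h₃⟩
    rcases hv.lt_or_eq with hv | rfl
    exacts [mix_of_lt _ _ hv, (mix_of_le _ _ le_rfl).trans hd]

theorem take_succ_of_lt {j : ℕ} (h : j < l.length) : l.take (j + 1) = l.take j ++ [l.getD j 0] := by
  rw [List.take_add_one, List.getD_eq_getElem?_getD, List.getElem?_eq_getElem h]
  rfl

theorem edgeCount_append (l l' : List ℕ) (S : Finset ℕ) :
    edgeCount n (l ++ l') S = edgeCount n l S + edgeCount n l' S := by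
  simp [edgeCount]

theorem degIn_append (l l' : List ℕ) (S : Finset ℕ) (v : ℕ) :
    degIn n (l ++ l') S v = degIn n l S v + degIn n l' S v := by
  simp [degIn]

theorem degIn_self {S : Finset ℕ} (hS : S ⊆ Finset.range n) : degIn n l S n = 0 := by
  have hn : ind S n = 0 := ind_eq_zero fun h => by simpa using hS h
  refine List.sum_eq_zero fun x hx => ?_
  obtain ⟨c, -, rfl⟩ := List.mem_map.1 hx
  unfold inside incidence
  by_cases h₁ : n = c / (n + 1)
  · rw [← h₁, hn]; simp
  by_cases h₂ : n = c % (n + 1)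
  · rw [← h₂, hn]; simp
  simp [h₁, h₂]

theorem runs_countProg (hb : PeelBounds n K l B W A) (hρ : PeelRegs n K l ρ) {o d : ℕ → ℕ}
    {S : Finset ℕ} (hd : ∀ v ≤ n, d v = 0) :
    Runs I W A countProg (l.length * 43 + 8) (PMF.pure ())
      (fun _ ρ' m' => Frame 14 ρ ρ' ∧ ρ' 14 = edgeCount n l S ∧
        ∃ d', (∀ v ≤ n, d' v = degIn n l S v) ∧ m' = layout n o (ind S) d' l)
      ρ (layout n o (ind S) d l) := by
  have h₁ := hb.nodes
  have h₂ := hb.le_word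
  have h₃ := hb.addr
  have key : Runs I W A (.const 14 0) 1 (PMF.pure ()) (fun _ ρ' m' => Frame 14 ρ ρ' ∧ ρ' 14 = 0 ∧
      m' = layout n o (ind S) d l) ρ (layout n o (ind S) d l) :=
    Runs.straight (by omega) (by omega) le_rfl (by simp [wp, frame_update, Frame.refl])
  refine (key.seq_pure (t₂ := l.length * 43 + 6) fun ρ₁ m₁ hρ₁ => ?_).mono (by omega)
    fun _ _ _ h => h
  refine (Runs.forLoop_pure (τ := 35) (Inv := fun j ρ' m' => Frame 14 ρ ρ' ∧
    ρ' 14 = edgeCount n (l.take j) S ∧ ∃ d', (∀ v ≤ n, d' v = degIn n (l.take j) S v) ∧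
      m' = layout n o (ind S) d' l)
    (by decide) (by decide) (by decide) (by omega) (by omega) (hρ.frame (by omega) hρ₁.1).r7
    ?_ ?_ ?_).mono le_rfl ?_
  · intro j ρ' m' x y h
    simpa [frame_update] using h
  · rintro j hj ρ' m' h18 h7 ⟨hF, h14, d', hd', rfl⟩
    have hρ' := hρ.frame (by omega) hF
    obtain ⟨c, hc⟩ : ∃ c, c = l.getD j 0 := ⟨_, rfl⟩
    have hread : ∀ o a d, layout n o a d l (3 * n + 2 + j) = c := fun o a d => by
      rw [layout_edge, hc]
    have hcl : c ∈ l := by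
      rw [hc, List.getD_eq_getElem _ _ hj]
      exact List.getElem_mem hj
    have hq : c / (n + 1) ≤ n := hb.code c hcl
    have hr : c % (n + 1) ≤ n := Nat.lt_succ_iff.1 (Nat.mod_lt _ (by omega))
    have hin := inside_le n S c
    have hlen := (edgeCount_le_length n (l.take j) S).trans (List.length_take_le _ _)
    have hX : edgeCount n (l.take (j + 1)) S = edgeCount n (l.take j) S + inside n S c := by
      rw [take_succ_of_lt hj, edgeCount_append, ← hc]
      simp [edgeCount]
    have hD : ∀ v, degIn n (l.take (j + 1)) S v =
        degIn n (l.take j) S v + inside n S c * incidence n v c := by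
      intro v
      rw [take_succ_of_lt hj, degIn_append, ← hc]
      simp [degIn]
    have hD' : ∀ v ≤ n, d' v ≤ 2 * j := fun v hv => by
      have := degIn_le_length n (l.take j) S v
      rw [hd' v hv]
      rw [List.length_take] at this
      omega
    have e₁ := hD' _ hq
    have e₂ : Function.update d' (c / (n + 1)) (d' (c / (n + 1)) + inside n S c) (c % (n + 1)) ≤
        2 * j + 1 := by
      rw [Function.update_apply]
      split_ifs
      · omega
      · have := hD' _ hr; omega
    have hD'' : ∀ v ≤ n, Function.update (Function.update d' (c / (n + 1))
        (d' (c / (n + 1)) + inside n S c)) (c % (n + 1)) (Function.update d' (c / (n + 1))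
          (d' (c / (n + 1)) + inside n S c) (c % (n + 1)) + inside n S c) v =
        degIn n (l.take (j + 1)) S v := by
      intro v hv
      rw [hD, ← hd' v hv]
      simp only [Function.update_apply, incidence]
      split_ifs <;> simp_all
      omega
    have hmul : ind S (c / (n + 1)) * ind S (c % (n + 1)) = inside n S c := rfl
    generalize hx : inside n S c = x at *
    have hd₁ : c / ρ' 8 = c / (n + 1) := by rw [hρ'.r8]
    have hd₂ : c % ρ' 8 = c % (n + 1) := by rw [hρ'.r8]
    generalize c / (n + 1) = q at *
    generalize c % (n + 1) = r at *
    refine Runs.straight (by omega) (by omega) (by simp [block, Prog.cost]) ?_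
    simp [block, wp, Op.eval, h18, hρ'.r5, hρ'.r6, hd₁, hd₂, hρ'.r0, h14, hread,
      update_layout_deg hq, update_layout_deg hr, layout_alive hq, layout_alive hr, layout_deg hq,
      layout_deg hr, frame_update, hF, hmul, hX]
    refine ⟨by omega, by omega, by omega, by omega, by omega, by omega, by omega, by omega,
      by omega, by omega, by omega, by omega, by omega, by omega, by omega, by omega, hρ'.r7, _, hD'', rfl⟩
  · exact ⟨hρ₁.1, hρ₁.2.1, d, by simpa [degIn] using hd, hρ₁.2.2⟩
  · rintro - ρ' m' ⟨-, h₁, h₂, d', h₃, h₄⟩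
    rw [List.take_length] at h₂ h₃
    exact ⟨h₁, h₂, d', h₃, h₄⟩

/-- The set `O`, with the numbers `x` and `s` in the role of its edge count and its node count, is at
least as dense as all sets of survivors before round `i`. Initially `O` is the set of all nodes
and `x / s = 0 / 1`, whence the inequality in `attained`. -/
structure Best (n K : ℕ) (l : List ℕ) (i : ℕ) (O : Finset ℕ) (x s : ℕ) : Prop where
  subset : O ⊆ Finset.range n
  nonempty : O.Nonempty
  pos : 0 < s
  attained : x * O.card ≤ edgeCount n l O * s
  best : ∀ j < i, edgeCount n l (survivors n K l j) * s ≤ x * (survivors n K l j).card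
  le_length : x ≤ l.length
  le_nodes : s ≤ n

theorem edgeCount_empty : edgeCount n l ∅ = 0 := by
  refine List.sum_eq_zero fun x hx => ?_
  obtain ⟨c, -, rfl⟩ := List.mem_map.1 hx
  simp [inside, ind]

theorem Best.keep {i x s : ℕ} {O : Finset ℕ} (h : Best n K l i O x s)
    (h' : edgeCount n l (survivors n K l i) * s ≤ x * (survivors n K l i).card) :
    Best n K l (i + 1) O x s :=
  { h with
    best := fun j hj => by
      rcases (Nat.lt_succ_iff.1 hj).lt_or_eq with hj | rfl
      exacts [h.best j hj, h'] }

theorem Best.improve {i x s : ℕ} {O : Finset ℕ} (h : Best n K l i O x s)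
    (h' : x * (survivors n K l i).card < edgeCount n l (survivors n K l i) * s) :
    Best n K l (i + 1) (survivors n K l i) (edgeCount n l (survivors n K l i))
      (survivors n K l i).card where
  subset := survivors_subset n K l i
  nonempty := by
    rw [Finset.nonempty_iff_ne_empty]
    intro h₀
    simp [h₀, edgeCount_empty] at h'
  pos := by
    rw [Finset.card_pos, Finset.nonempty_iff_ne_empty]
    intro h₀
    simp [h₀, edgeCount_empty] at h'
  attained := le_rfl
  best j hj := by
    rcases (Nat.lt_succ_iff.1 hj).lt_or_eq with hj | rfl
    · refine Nat.le_of_mul_le_mul_right ?_ h.pos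
      calc edgeCount n l (survivors n K l j) * (survivors n K l i).card * s
          = edgeCount n l (survivors n K l j) * s * (survivors n K l i).card := by ring
        _ ≤ x * (survivors n K l j).card * (survivors n K l i).card :=
            Nat.mul_le_mul_right _ (h.best j hj)
        _ = x * (survivors n K l i).card * (survivors n K l j).card := by ring
        _ ≤ edgeCount n l (survivors n K l i) * s * (survivors n K l j).card :=
            Nat.mul_le_mul_right _ h'.le
        _ = _ := by ring
    · exact le_rfl
  le_length := edgeCount_le_length _ _ _
  le_nodes := by simpa using Finset.card_le_card (survivors_subset n K l i)

theorem runs_copyProg (hb : PeelBounds n K l B W A) (hρ : PeelRegs n K l ρ) {o d : ℕ → ℕ}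
    {S : Finset ℕ} (h13 : ρ 13 = S.card) (h14 : ρ 14 = edgeCount n l S)
    (hS : S ⊆ Finset.range n) :
    Runs I W A copyProg (n * 13 + 12) (PMF.pure ())
      (fun _ ρ' m' => (Frame 11 ρ ρ' ∧ ρ' 11 = edgeCount n l S ∧ ρ' 12 = S.card ∧
        ρ' 13 = S.card ∧ ρ' 14 = edgeCount n l S) ∧ m' = layout n (ind S) (ind S) d l)
      ρ (layout n o (ind S) d l) := by
  have h₁ := hb.nodes
  have h₂ := hb.le_word
  have h₃ := hb.addr
  have h₄ := edgeCount_le_length n l S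
  have h₅ := Finset.card_le_card hS
  rw [Finset.card_range] at h₅
  have key : Runs I W A (block [.const 21 0, .op .add 11 14 21, .op .add 12 13 21]) 5 (PMF.pure ())
      (fun _ ρ' m' => (Frame 11 ρ ρ' ∧ ρ' 11 = edgeCount n l S ∧ ρ' 12 = S.card ∧
        ρ' 13 = S.card ∧ ρ' 14 = edgeCount n l S) ∧ m' = layout n o (ind S) d l)
      ρ (layout n o (ind S) d l) :=
    Runs.straight (by omega) (by omega) le_rfl (by
      simp [block, wp, h13, h14, frame_update, Frame.refl]
      omega)
  refine (key.seq_pure (t₂ := n * 13 + 6) fun ρ₁ m₁ hρ₁ => ?_).mono (by omega) fun _ _ _ h => h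
  refine (Runs.forLoop_pure (τ := 5) (Inv := fun j ρ' m' => (Frame 11 ρ ρ' ∧
    ρ' 11 = edgeCount n l S ∧ ρ' 12 = S.card ∧ ρ' 13 = S.card ∧ ρ' 14 = edgeCount n l S) ∧
    m' = layout n (mix j (ind S) o) (ind S) d l)
    (by decide) (by decide) (by decide) (by omega) (by omega) (hρ.frame (by omega) hρ₁.1.1).r0
    ?_ ?_ ?_).mono le_rfl ?_
  · intro j ρ' m' x y h
    simpa [frame_update] using h
  · rintro j hj ρ' m' h18 h0 ⟨h, rfl⟩
    refine Runs.straight (by omega) (by omega) (by simp [block, Prog.cost]) ?_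
    simp [block, wp, h18, h0, layout_alive hj.le, update_layout_out hj, frame_update, h,
      update_mix]
    omega
  · exact hρ₁
  · rintro - ρ' m' ⟨-, h₁, h₂⟩
    exact ⟨h₁, h₂.trans (layout_congr (fun v hv => mix_of_lt _ _ hv) (fun _ _ => rfl)
      fun _ _ => rfl)⟩

theorem runs_improveProg (hb : PeelBounds n K l B W A) (hρ : PeelRegs n K l ρ) {d : ℕ → ℕ}
    {i : ℕ} {O : Finset ℕ} (hO : Best n K l i O (ρ 11) (ρ 12))
    (h13 : ρ 13 = (survivors n K l i).card)
    (h14 : ρ 14 = edgeCount n l (survivors n K l i)) :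
    Runs I W A improveProg (n * 13 + 19) (PMF.pure ())
      (fun _ ρ' m' => Frame 11 ρ ρ' ∧ ρ' 13 = (survivors n K l i).card ∧
        ρ' 14 = edgeCount n l (survivors n K l i) ∧ ∃ O', Best n K l (i + 1) O' (ρ' 11) (ρ' 12) ∧
        m' = layout n (ind O') (ind (survivors n K l i)) d l)
      ρ (layout n (ind O) (ind (survivors n K l i)) d l) := by
  have h₁ := hb.nodes
  have h₂ := hb.le_word
  have hS := survivors_subset n K l i
  have h₄ := edgeCount_le_length n l (survivors n K l i)
  have h₅ := Finset.card_le_card hS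
  rw [Finset.card_range] at h₅
  have h₆ := hO.le_length
  have h₇ := hO.le_nodes
  have h₈ : edgeCount n l (survivors n K l i) * ρ 12 ≤ B * B :=
    Nat.mul_le_mul (by omega) (by omega)
  have h₉ : ρ 11 * (survivors n K l i).card ≤ B * B := Nat.mul_le_mul (by omega) (by omega)
  have key : Runs I W A (block [.op .mul 20 14 12, .op .mul 21 11 13, .op .lt 20 21 20]) 5
      (PMF.pure ()) (fun _ ρ' m' => (Frame 15 ρ ρ' ∧ ρ' 20 = (if ρ 11 * (survivors n K l i).card <
        edgeCount n l (survivors n K l i) * ρ 12 then 1 else 0)) ∧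
        m' = layout n (ind O) (ind (survivors n K l i)) d l)
      ρ (layout n (ind O) (ind (survivors n K l i)) d l) :=
    Runs.straight (by omega) (by omega) le_rfl (by
      simp [block, wp, Op.eval, h13, h14, frame_update, Frame.refl]
      omega)
  refine (key.seq_pure (t₂ := n * 13 + 13) ?_).mono (by omega) fun _ _ _ h => h
  rintro ρ₁ _ ⟨⟨hF, h20⟩, rfl⟩
  have h13' := (hF 13 (by omega)).trans h13
  have h14' := (hF 14 (by omega)).trans h14
  refine (Runs.cond (t := n * 13 + 12) (fun h => ?_) fun h => ?_).mono (by omega) fun _ _ _ h => h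
  · refine (runs_copyProg hb (hρ.frame (by omega) hF) h13' h14' hS).mono le_rfl ?_
    rintro - ρ' m' ⟨⟨e₁, e₂, e₃, e₄, e₅⟩, e₆⟩
    refine ⟨(hF.mono (by omega)).trans e₁, e₄, e₅, survivors n K l i, ?_, e₆⟩
    rw [e₂, e₃]
    exact hO.improve (by by_contra h'; simp [h20, h'] at h)
  · refine Runs.straight (p := .skip) (by omega) (by omega) (by simp [Prog.cost])
      ⟨hF.mono (by omega), h13', h14', O, ?_, rfl⟩
    rw [hF 11 (by omega), hF 12 (by omega)]
    exact hO.keep (by by_contra h'; simp [h20, not_le.1 h'] at h)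

theorem runs_removeProg (hb : PeelBounds n K l B W A) (hρ : PeelRegs n K l ρ) {o d : ℕ → ℕ}
    {S : Finset ℕ} (h13 : ρ 13 = S.card) (h14 : ρ 14 = edgeCount n l S)
    (hS : S ⊆ Finset.range n) (hd : ∀ v ≤ n, d v = degIn n l S v) :
    Runs I W A removeProg (n * 23 + 16) (PMF.pure ())
      (fun _ ρ' m' => Frame 15 ρ ρ' ∧ m' = layout n o (ind (peel n K l S)) d l)
      ρ (layout n o (ind S) d l) := by
  have h₁ := hb.nodes
  have h₂ := hb.le_word
  have h₃ := hb.addr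
  have h₄ := edgeCount_le_length n l S
  have h₅ := Finset.card_le_card hS
  rw [Finset.card_range] at h₅
  have h₆ := hb.acc
  have h₇ : 2 * ((K + 1) * edgeCount n l S) ≤ B * B :=
    calc 2 * ((K + 1) * edgeCount n l S) = (K + 1) * (2 * edgeCount n l S) := by ring
      _ ≤ B * B := Nat.mul_le_mul h₆ (by omega)
  have h₈ : S.card * K ≤ B * B := Nat.mul_le_mul (by omega) (by omega)
  have hword := hb.word
  have key : Runs I W A (block [.const 20 1, .op .add 15 4 20, .op .mul 15 15 14,
      .op .add 15 15 15, .op .mul 16 13 4]) 9 (PMF.pure ())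
      (fun _ ρ' m' => (Frame 15 ρ ρ' ∧ ρ' 15 = 2 * ((K + 1) * edgeCount n l S) ∧
        ρ' 16 = S.card * K) ∧ m' = layout n o (ind S) d l)
      ρ (layout n o (ind S) d l) :=
    Runs.straight (by omega) (by omega) le_rfl (by
      simp [block, wp, h13, h14, hρ.r4, frame_update, Frame.refl]
      omega)
  refine (key.seq_pure (t₂ := n * 23 + 6) fun ρ₁ m₁ hρ₁ => ?_).mono (by omega) fun _ _ _ h => h
  refine (Runs.forLoop_pure (τ := 15) (Inv := fun j ρ' m' => (Frame 15 ρ ρ' ∧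
    ρ' 15 = 2 * ((K + 1) * edgeCount n l S) ∧ ρ' 16 = S.card * K) ∧
      m' = layout n o (mix j (ind (peel n K l S)) (ind S)) d l)
    (by decide) (by decide) (by decide) (by omega) (by omega) (hρ.frame (by omega) hρ₁.1.1).r0
    ?_ ?_ ?_).mono le_rfl ?_
  · intro j ρ' m' x y h
    simpa [frame_update] using h
  · rintro j hj ρ' m' h18 h0 ⟨⟨hF, h15, h16⟩, rfl⟩
    have hρ' := hρ.frame (by omega) hF
    have h₉ : degIn n l S j * (S.card * K) ≤ B * B * B := by
      rw [mul_assoc B B B]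
      exact Nat.mul_le_mul ((degIn_le_length n l S j).trans (by omega)) h₈
    have h₁₀ := ind_le S j
    have hpeel : ind S j * (if 2 * ((K + 1) * edgeCount n l S) < degIn n l S j * (S.card * K) then
        1 else 0) = ind (peel n K l S) j := by
      simp only [ind, peel, Finset.mem_filter]
      split_ifs <;> simp_all
    have h₁₁ := ind_le (peel n K l S) j
    refine Runs.straight (by omega) (by omega) (by simp [block, Prog.cost]) ?_
    simp [-mul_ite, block, wp, Op.eval, h18, hρ'.r5, hρ'.r0, h15, h16, layout_alive hj.le,
      layout_deg hj.le, hd j hj.le, update_layout_alive hj.le, frame_update, hF,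
      mix_of_le _ _ (le_refl j), hpeel, update_mix]
    omega
  · exact hρ₁
  · rintro - ρ' m' ⟨-, h₁, h₂⟩
    refine ⟨h₁.1, h₂.trans (layout_congr (fun _ _ => rfl) (fun v hv => ?_) fun _ _ => rfl)⟩
    rcases hv.lt_or_eq with hv | rfl
    · exact mix_of_lt _ _ hv
    · rw [mix_of_le _ _ le_rfl, ind_eq_zero fun h => by simpa using hS h,
        ind_eq_zero fun h => by simpa using hS (Finset.mem_of_mem_filter _ h)]

/-- The state of the machine before round `i` of peeling. -/
def PeelState (n K : ℕ) (l : List ℕ) (i : ℕ) (ρ m : ℕ → ℕ) : Prop :=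
  ∃ O d, d n = 0 ∧ Best n K l i O (ρ 11) (ρ 12) ∧
    m = layout n (ind O) (ind (survivors n K l i)) d l

theorem runs_roundProg (hb : PeelBounds n K l B W A) (hρ : PeelRegs n K l ρ) {m : ℕ → ℕ} {i : ℕ}
    (h : PeelState n K l i ρ m) :
    Runs I W A roundProg (n * 55 + l.length * 43 + 54) (PMF.pure ())
      (fun _ ρ' m' => Frame 11 ρ ρ' ∧ PeelState n K l (i + 1) ρ' m') ρ m := by
  obtain ⟨O, d, hd, hO, rfl⟩ := h
  have hS := survivors_subset n K l i
  refine ((runs_resetProg hb hρ hS hd).seq_pure (t₂ := n * 36 + l.length * 43 + 45) ?_).mono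
    (by omega) fun _ _ _ h => h
  rintro ρ₁ m₁ ⟨hF₁, h13, d₁, hd₁, rfl⟩
  refine ((runs_countProg hb (hρ.frame (by omega) hF₁) hd₁).seq_pure (t₂ := n * 36 + 36) ?_).mono
    (by omega) fun _ _ _ h => h
  rintro ρ₂ m₂ ⟨hF₂, h14, d₂, hd₂, rfl⟩
  have hF := hF₁.trans (hF₂.mono (by omega))
  refine ((runs_improveProg hb (hρ.frame (by omega) hF) (O := O) (d := d₂) ?_
    ((hF₂ 13 (by omega)).trans h13) h14).seq_pure (t₂ := n * 23 + 16) ?_).mono (by omega)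
    fun _ _ _ h => h
  · rw [hF 11 (by omega), hF 12 (by omega)]
    exact hO
  rintro ρ₃ m₃ ⟨hF₃, h13, h14, O', hO', rfl⟩
  have hF := (hF.mono (by omega)).trans hF₃
  refine (runs_removeProg hb (hρ.frame (by omega) hF) h13 h14 hS hd₂).mono le_rfl ?_
  rintro - ρ' m' ⟨hF₄, rfl⟩
  refine ⟨hF.trans (hF₄.mono (by omega)), O', d₂, (hd₂ n le_rfl).trans (degIn_self hS), ?_, rfl⟩
  rw [hF₄ 11 (by omega), hF₄ 12 (by omega)]
  exact hO'

end Peel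

/-! ### The program: parameters, sampling and the main program -/

/-- Set register `2` to `Nat.size n`, by repeated halving. -/
def sizeProg : Prog :=
  .seq (block [.const 2 0, .op .add 20 0 2, .const 21 2, .const 22 1])
    (.loop 20 (.seq (.op .div 20 20 21) (.op .add 2 2 22)))

/-- Set register `3` to the sum of all degrees. -/
def totalDegreeProg : Prog :=
  .seq (.const 3 0) (forLoop 18 0 19 (block [.degree 20 18, .op .add 3 3 20]))

/-- Compute the remaining parameters. -/
def paramProg (M : ℕ) : Prog :=
  block [.const 20 M, .op .mul 20 20 2, .op .mul 20 20 1, .op .mul 20 20 1, .op .mul 20 20 0,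
    .op .div 3 3 20, .const 21 0, .op .eq 21 3 21, .op .add 3 3 21, .const 20 16,
    .op .mul 4 20 1, .const 20 1, .op .add 8 0 20, .op .add 5 0 8, .op .add 6 5 8,
    .op .mul 9 4 2, .const 7 0]

/-- Divide the incidence list of every node into intervals of length `w` (register `3`), draw a
uniformly random position in each of them, and store the node together with the entry at this
position. In the last interval the drawn position may lie beyond the end of the list; then the
answer `n` of the oracle is stored. -/
def sampleProg : Prog :=
  forLoop 10 0 17 (.seq (block [.degree 20 10, .const 21 1, .op .add 22 20 3, .op .sub 22 22 21,
      .op .div 22 22 3, .op .mul 23 10 8])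
    (forLoop 18 22 19 (.seq (.rand 24 3) (block [.op .mul 25 18 3, .op .add 25 25 24,
      .neighbor 24 10 25, .op .add 24 23 24, .op .add 25 6 7, .store 25 24, .const 25 1,
      .op .add 7 7 25]))))

/-- All nodes survive, and the set of all nodes is the best set. -/
def startProg : Prog :=
  .seq (forLoop 18 0 19 (block [.const 20 1, .store 18 20, .op .add 21 0 18, .store 21 20]))
    (block [.const 11 0, .const 12 1])

/-- Write the output number to registers `0` and `1`. -/
def outputProg : Prog :=
  block [.op .mul 0 11 3, .op .mul 0 0 4, .const 20 1, .op .add 4 4 20, .op .mul 1 12 4,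
    .op .add 1 1 1]

/-- The algorithm. The number `M` determines the size of the sample. -/
def mainProg (M : ℕ) : Prog :=
  block [sizeProg, totalDegreeProg, paramProg M, sampleProg, startProg, forLoop 10 9 17 roundProg,
    outputProg]

section Sample

variable {n : ℕ} {G : SimpleGraph (Fin n)} (I : IncidenceList G)

/-- The sum of all degrees. -/
def IncidenceList.totalDegree : ℕ := ∑ v ∈ Finset.range n, I.degreeQuery v

/-- The length of the intervals from which one position is drawn: `D / q`, but at least `1`. -/
def sampleWidth (q : ℕ) : ℕ :=
  I.totalDegree / q + (if I.totalDegree / q = 0 then 1 else 0)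

/-- The number of intervals of length `w` into which the incidence list of `v` is divided. -/
def intervals (w v : ℕ) : ℕ := (I.degreeQuery v + w - 1) / w

/-- Append to `l` the code of the pair of `v` and a random entry in the `j`-th interval of the
incidence list of `v`. -/
noncomputable def drawEdge (w v j : ℕ) (l : List ℕ) : PMF (List ℕ) :=
  (uniformBelow w).map fun x => l ++ [v * (n + 1) + I.neighborQuery v (j * w + x)]

/-- The distribution of the sample: one draw from each interval of each incidence list, all of them
independent. -/
noncomputable def sample (w : ℕ) : PMF (List ℕ) :=
  iterate (fun v => iterate (drawEdge I w v) 0 (intervals I w v)) 0 n []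

/-- The size of the sample. -/
def sampleSize (w : ℕ) : ℕ := ∑ v ∈ Finset.range n, intervals I w v

variable {I} {W A B : ℕ} {ρ m : ℕ → ℕ}

theorem sampleWidth_pos (q : ℕ) : 0 < sampleWidth I q := by
  unfold sampleWidth
  generalize I.totalDegree / q = x
  split_ifs <;> omega

theorem IncidenceList.totalDegree_le : I.totalDegree ≤ n * n := by
  simpa [totalDegree] using Finset.sum_le_card_nsmul (Finset.range n) I.degreeQuery n
    fun v _ => I.degreeQuery_le v

theorem sampleWidth_le (q : ℕ) : sampleWidth I q ≤ n * n + 1 := by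
  have := Nat.div_le_self I.totalDegree q
  have := I.totalDegree_le
  unfold sampleWidth
  split_ifs <;> omega

theorem size_div_two {t : ℕ} (ht : t ≠ 0) : t.size = (t / 2).size + 1 := by
  refine le_antisymm (Nat.size_le.2 ?_) (Nat.lt_size.2 ?_)
  · have := Nat.lt_size_self (t / 2)
    rw [pow_succ]
    omega
  · rcases Nat.eq_zero_or_pos (t / 2).size with h | h
    · rw [h]; simp; omega
    · obtain ⟨s, hs⟩ := Nat.exists_eq_add_of_le' h
      have := Nat.lt_size.1 (show s < (t / 2).size by omega)
      rw [hs, pow_succ]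
      omega

theorem runs_halving (hn : n ≤ W) (h21 : ρ 21 = 2) (h22 : ρ 22 = 1) (t : ℕ)
    (h20 : ρ 20 = t) (hW : ρ 2 + t.size ≤ W) (hW' : 1 ≤ W) :
    Runs I W A (.loop 20 (.seq (.op .div 20 20 21) (.op .add 2 2 22))) (t.size * 4 + 1)
      (PMF.pure ()) (fun _ ρ' m' => (ρ' 0 = ρ 0 ∧ ρ' 1 = ρ 1 ∧ ρ' 2 = ρ 2 + t.size) ∧ m' = m)
      ρ m := by
  induction t using Nat.strong_induction_on generalizing ρ with
  | _ t ih =>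
    by_cases ht : t = 0
    · subst ht
      exact (Runs.loop_done h20 (by simp)).mono (by simp) fun _ _ _ h => h
    · rw [size_div_two ht] at hW ⊢
      have h₁ : Runs I W A (.seq (.op .div 20 20 21) (.op .add 2 2 22)) 3 (PMF.pure ())
          (fun _ ρ' m' => (ρ' 0 = ρ 0 ∧ ρ' 1 = ρ 1 ∧ ρ' 2 = ρ 2 + 1 ∧ ρ' 20 = t / 2 ∧ ρ' 21 = 2 ∧
            ρ' 22 = 1) ∧ m' = m) ρ m :=
        Runs.straight hW' hn (by simp [Prog.cost]) (by simp [wp, Op.eval, h20, h21, h22]; omega)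
      have h₂ := Runs.loop_step (R := fun _ ρ' m' => (ρ' 0 = ρ 0 ∧ ρ' 1 = ρ 1 ∧
        ρ' 2 = ρ 2 + ((t / 2).size + 1)) ∧ m' = m) (t₂ := (t / 2).size * 4 + 1)
        (κ := fun _ => PMF.pure ()) (h20 ▸ ht) h₁ ?_
      · rw [PMF.pure_bind] at h₂
        exact h₂.mono (by omega) fun _ _ _ h => h
      · rintro - ρ' m' ⟨⟨e₀, e₁, e₂, e₃, e₄, e₅⟩, rfl⟩
        refine (ih (t / 2) (by omega) e₄ e₅ e₃ (by omega)).mono le_rfl ?_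
        rintro - ρ'' m'' ⟨⟨f₀, f₁, f₂⟩, h⟩
        exact ⟨⟨f₀.trans e₀, f₁.trans e₁, by omega⟩, h⟩

theorem size_le_self (t : ℕ) : t.size ≤ t := Nat.size_le.2 Nat.lt_two_pow_self

theorem runs_sizeProg (hn : n + 2 ≤ W) (h0 : ρ 0 = n) :
    Runs I W A sizeProg (n.size * 4 + 9) (PMF.pure ())
      (fun _ ρ' m' => (ρ' 0 = n ∧ ρ' 1 = ρ 1 ∧ ρ' 2 = n.size) ∧ m' = m) ρ m := by
  have key : Runs I W A (block [.const 2 0, .op .add 20 0 2, .const 21 2, .const 22 1]) 7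
      (PMF.pure ()) (fun _ ρ' m' => (ρ' 0 = n ∧ ρ' 1 = ρ 1 ∧ ρ' 2 = 0 ∧ ρ' 20 = n ∧ ρ' 21 = 2 ∧
        ρ' 22 = 1) ∧ m' = m) ρ m :=
    Runs.straight (by omega) (by omega) le_rfl (by simp [block, wp, h0]; omega)
  refine (key.seq_pure (t₂ := n.size * 4 + 1) ?_).mono (by omega) fun _ _ _ h => h
  rintro ρ₁ m₁ ⟨⟨h0, h1, h2, h20, h21, h22⟩, rfl⟩
  have := size_le_self n
  refine (runs_halving (by omega) h21 h22 n h20 (by omega) (by omega)).mono le_rfl ?_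
  rintro - ρ' m' ⟨⟨f₀, f₁, f₂⟩, h⟩
  exact ⟨⟨f₀.trans h0, f₁.trans h1, by omega⟩, h⟩

theorem runs_totalDegreeProg (hn : n * n + n < W) (h0 : ρ 0 = n) :
    Runs I W A totalDegreeProg (n * 11 + 8) (PMF.pure ())
      (fun _ ρ' m' => (Frame 3 ρ ρ' ∧ ρ' 3 = I.totalDegree) ∧ m' = m) ρ m := by
  have key : Runs I W A (.const 3 0) 1 (PMF.pure ())
      (fun _ ρ' m' => (Frame 3 ρ ρ' ∧ ρ' 3 = 0) ∧ m' = m) ρ m :=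
    Runs.straight (by omega) (by omega) le_rfl (by simp [wp, frame_update, Frame.refl])
  refine (key.seq_pure (t₂ := n * 11 + 6) fun ρ₁ m₁ hρ₁ => ?_).mono (by omega) fun _ _ _ h => h
  refine (Runs.forLoop_pure (τ := 3) (Inv := fun j ρ' m' => (Frame 3 ρ ρ' ∧
    ρ' 3 = ∑ v ∈ Finset.range j, I.degreeQuery v) ∧ m' = m)
    (by decide) (by decide) (by decide) (by omega) (by omega) ((hρ₁.1.1 0 (by omega)).trans h0)
    ?_ ?_ ?_).mono le_rfl ?_
  · intro j ρ' m' x y h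
    simpa [frame_update] using h
  · rintro j hj ρ' m' h18 h0 ⟨h, rfl⟩
    have h₁ : ∑ v ∈ Finset.range (j + 1), I.degreeQuery v ≤ I.totalDegree :=
      Finset.sum_le_sum_of_subset (Finset.range_subset_range.2 hj)
    have h₂ := I.totalDegree_le
    refine Runs.straight (by omega) (by omega) (by simp [block, Prog.cost]) ?_
    rw [Finset.sum_range_succ] at h₁
    simp [block, wp, h18, h, h0, frame_update, Finset.sum_range_succ]
    omega
  · simpa using hρ₁
  · rintro - ρ' m' ⟨-, h⟩
    exact h

theorem runs_paramProg {M k ℓ : ℕ} (hn : 1 ≤ n) (hk : 1 ≤ k) (hℓ : 1 ≤ ℓ) (hM : 16 ≤ M)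
    (hB : M * ℓ * k * k * n ≤ B) (hnB : 3 * n + 2 ≤ B) (hW : B * B ≤ W)
    (h0 : ρ 0 = n) (h1 : ρ 1 = k) (h2 : ρ 2 = ℓ) (h3 : ρ 3 = I.totalDegree) :
    Runs I W A (paramProg M) 33 (PMF.pure ())
      (fun _ ρ' m' => (ρ' 0 = n ∧ ρ' 3 = sampleWidth I (M * ℓ * k * k * n) ∧ ρ' 4 = 16 * k ∧
        ρ' 5 = 2 * n + 1 ∧ ρ' 6 = 3 * n + 2 ∧ ρ' 7 = 0 ∧ ρ' 8 = n + 1 ∧ ρ' 9 = 16 * k * ℓ) ∧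
        m' = m) ρ m := by
  have a₁ : M ≤ M * ℓ := Nat.le_mul_of_pos_right _ hℓ
  have a₂ : M * ℓ ≤ M * ℓ * k := Nat.le_mul_of_pos_right _ hk
  have a₃ : M * ℓ * k ≤ M * ℓ * k * k := Nat.le_mul_of_pos_right _ hk
  have a₄ : M * ℓ * k * k ≤ M * ℓ * k * k * n := Nat.le_mul_of_pos_right _ hn
  have a₅ : 16 * k * ℓ ≤ M * ℓ * k := by
    rw [mul_right_comm]
    exact Nat.mul_le_mul_right _ (Nat.mul_le_mul_right _ hM)
  have a₆ : 16 * k ≤ 16 * k * ℓ := Nat.le_mul_of_pos_right _ hℓ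
  have a₇ : B * 2 ≤ B * B := Nat.mul_le_mul_left _ (by omega)
  have a₈ := Nat.mul_le_mul (show n ≤ B by omega) (show n + 1 ≤ B by omega)
  have a₉ : sampleWidth I (M * ℓ * k * k * n) ≤ W := by
    have := sampleWidth_le (I := I) (M * ℓ * k * k * n)
    rw [mul_add] at a₈
    omega
  refine Runs.straight (by omega) (by omega) (by simp [block, paramProg, Prog.cost]) ?_
  rw [sampleWidth] at a₉ ⊢
  simp [-mul_ite, paramProg, block, wp, Op.eval, h0, h1, h2, h3, -Nat.div_eq_zero_iff]
  omega

/-- The state of the machine during sampling, when the sample is `l`. -/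
def SampleState (n : ℕ) (l : List ℕ) (ρ₀ ρ m : ℕ → ℕ) : Prop :=
  (Frame 7 ρ₀ ρ ∧ ρ 8 = n + 1 ∧ ρ 9 = ρ₀ 9 ∧ ρ 7 = l.length) ∧ (∀ c ∈ l, c / (n + 1) ≤ n) ∧
    m = layout n (fun _ => 0) (fun _ => 0) (fun _ => 0) l

theorem runs_drawEdge {w v j : ℕ} {l : List ℕ} {ρ₀ : ℕ → ℕ} (hw : 0 < w) (hv : v < n)
    (hj : j < intervals I w v) (hl : 3 * n + 2 + l.length < A) (hA : A ≤ W)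
    (hW : n * n + 3 * n + w < W) (h3 : ρ₀ 3 = w) (h6 : ρ₀ 6 = 3 * n + 2)
    (h10 : ρ 10 = v) (h18 : ρ 18 = j) (h22 : ρ 22 = intervals I w v) (h23 : ρ 23 = v * (n + 1))
    (h : SampleState n l ρ₀ ρ m) :
    Runs I W A (.seq (.rand 24 3) (block [.op .mul 25 18 3, .op .add 25 25 24,
      .neighbor 24 10 25, .op .add 24 23 24, .op .add 25 6 7, .store 25 24, .const 25 1,
      .op .add 7 7 25])) 17 (drawEdge I w v j l)
      (fun l' ρ' m' => (ρ' 10 = v ∧ ρ' 18 = j ∧ ρ' 22 = intervals I w v ∧ ρ' 23 = v * (n + 1)) ∧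
        l'.length = l.length + 1 ∧ SampleState n l' ρ₀ ρ' m') ρ m := by
  obtain ⟨⟨hF, h8, h9, h7⟩, hc, rfl⟩ := h
  have h3' := (hF 3 (by omega)).trans h3
  have h6' := (hF 6 (by omega)).trans h6
  have h₁ : Runs I W A (.rand 24 3) 1 (uniformBelow w) (fun x ρ' m' => x < w ∧
      ρ' = Function.update ρ 24 x ∧ m' = layout n (fun _ => 0) (fun _ => 0) (fun _ => 0) l) ρ
      (layout n (fun _ => 0) (fun _ => 0) (fun _ => 0) l) := by
    have := Runs.rand (I := I) (W := W) (A := A) (m := layout n (fun _ => 0) (fun _ => 0)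
      (fun _ => 0) l) (r := 24) (a := 3) (ρ := ρ) (Q := fun x ρ' m' => x < w ∧
      ρ' = Function.update ρ 24 x ∧ m' = layout n (fun _ => 0) (fun _ => 0) (fun _ => 0) l)
      (by omega) fun x hx => ⟨by omega, rfl, rfl⟩
    rwa [h3'] at this
  have hjw : j * w ≤ n + w := by
    have h₁ := Nat.mul_le_mul_right w hj.le
    have h₂ := Nat.div_mul_le_self (I.degreeQuery v + w - 1) w
    have h₃ := I.degreeQuery_le v
    rw [intervals] at h₁
    omega
  have hvn : v * (n + 1) + n ≤ n * n + n := by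
    have := Nat.mul_le_mul_right (n + 1) (show v + 1 ≤ n by omega)
    rw [add_mul, mul_add n n] at this
    omega
  refine (h₁.seq (t₂ := 15) (κ := fun x => PMF.pure
    (l ++ [v * (n + 1) + I.neighborQuery v (j * w + x)])) ?_).mono le_rfl fun _ _ _ h => h
  rintro x ρ' m' ⟨hx, rfl, rfl⟩
  have hu := I.neighborQuery_le v (j * w + x)
  have hjn : j * w + x ≤ W := by
    have : n ≤ n * n := Nat.le_mul_self n
    have := I.degreeQuery_le v
    have h₁ := Nat.mul_le_mul_right w (Nat.succ_le_of_lt hj)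
    have h₂ := Nat.div_mul_le_self (I.degreeQuery v + w - 1) w
    rw [intervals] at h₁
    rw [Nat.succ_mul] at h₁
    omega
  refine Runs.straight (by omega) (by omega) (by simp [block, Prog.cost]) ?_
  simp [block, wp, h10, h18, h22, h23, h3', h6', h7, h8, h9, hF, frame_update, SampleState,
    update_layout_edge]
  refine ⟨by omega, by omega, by omega, by omega, by omega, by omega, by omega, ?_⟩
  rintro c (h | rfl)
  · exact hc c h
  · rw [Nat.mul_comm, Nat.mul_add_div (by omega), Nat.div_eq_of_lt (by omega)]
    omega

theorem runs_sampleProg {w : ℕ} (hw : 0 < w) (hA : 3 * n + 2 + sampleSize I w ≤ A) (hAW : A ≤ W)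
    (hW : n * n + 3 * n + w < W) (h0 : ρ 0 = n) (h3 : ρ 3 = w) (h6 : ρ 6 = 3 * n + 2)
    (h7 : ρ 7 = 0) (h8 : ρ 8 = n + 1) :
    Runs I W A sampleProg (n * 26 + sampleSize I w * 25 + 6) (sample I w)
      (fun l ρ' m' => l.length = sampleSize I w ∧ SampleState n l ρ ρ' m') ρ (fun _ => 0) := by
  have time : ∑ v ∈ Finset.range n, (18 + intervals I w v * 25 + 8) =
      n * 26 + sampleSize I w * 25 := by
    simp only [Finset.sum_add_distrib, Finset.sum_const, Finset.card_range, smul_eq_mul,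
      ← Finset.sum_mul, sampleSize]
    ring
  rw [← time]
  refine (Runs.forLoop (Inv := fun v l ρ' m' => l.length = ∑ u ∈ Finset.range v, intervals I w u ∧
    SampleState n l ρ ρ' m') (by decide) (by decide) (by decide) (by omega) (by omega) h0
    ?_ ?_ ?_).mono le_rfl fun l ρ' m' h => h.2
  · intro v l ρ' m' x y h
    simpa [frame_update, SampleState] using h
  · rintro v hv l ρ₁ m₁ h10 h0' ⟨hlen, h⟩
    have hsum : ∑ u ∈ Finset.range v, intervals I w u + intervals I w v ≤ sampleSize I w := by
      rw [← Finset.sum_range_succ]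
      exact Finset.sum_le_sum_of_subset (Finset.range_subset_range.2 hv)
    have hd := I.degreeQuery_le v
    have hvn : v * (n + 1) ≤ n * n + n := by
      have := Nat.mul_le_mul_right (n + 1) hv.le
      rwa [mul_add n n, mul_one] at this
    have h3' := (h.1.1 3 (by omega)).trans h3
    have key : Runs I W A (block [.degree 20 10, .const 21 1, .op .add 22 20 3, .op .sub 22 22 21,
        .op .div 22 22 3, .op .mul 23 10 8]) 11 (PMF.pure ()) (fun _ ρ' m' =>
          (ρ' 10 = v ∧ ρ' 22 = intervals I w v ∧ ρ' 23 = v * (n + 1)) ∧ SampleState n l ρ ρ' m')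
        ρ₁ m₁ := by
      refine Runs.straight (by omega) (by omega) (by simp [block, Prog.cost]) ?_
      simp only [SampleState] at h ⊢
      simp [block, wp, Op.eval, h10, h3', h, frame_update, intervals]
      exact ⟨by omega, by omega, by omega, h.2.1⟩
    have hloop : ∀ ρ₂ m₂, (ρ₂ 10 = v ∧ ρ₂ 22 = intervals I w v ∧ ρ₂ 23 = v * (n + 1)) ∧
        SampleState n l ρ ρ₂ m₂ → Runs I W A (forLoop 18 22 19 (.seq (.rand 24 3)
          (block [.op .mul 25 18 3, .op .add 25 25 24, .neighbor 24 10 25, .op .add 24 23 24,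
            .op .add 25 6 7, .store 25 24, .const 25 1, .op .add 7 7 25])))
          (intervals I w v * 25 + 6) (iterate (drawEdge I w v) 0 (intervals I w v) l)
          (fun l' ρ' m' => ρ' 10 = v ∧ ρ' 0 = n ∧ l'.length =
            ∑ u ∈ Finset.range (v + 1), intervals I w u ∧ SampleState n l' ρ ρ' m') ρ₂ m₂ := by
      rintro ρ₂ m₂ ⟨⟨g10, g22, g23⟩, h₂⟩
      have time : ∑ j ∈ Finset.range (intervals I w v), (17 + 8) = intervals I w v * 25 := by
        simp
      rw [← time]
      refine (Runs.forLoop (τ := fun _ => 17) (Inv := fun j l' ρ' m' => (ρ' 10 = v ∧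
        ρ' 23 = v * (n + 1)) ∧ l'.length = l.length + j ∧ SampleState n l' ρ ρ' m')
        (by decide) (by decide) (by decide) (by omega) (by omega) g22 ?_ ?_ ?_).mono le_rfl ?_
      · intro j l' ρ' m' x y h
        simpa [frame_update, SampleState] using h
      · rintro j hj l' ρ₃ m₃ e18 e22 ⟨⟨e10, e23⟩, hl', h₃⟩
        refine (runs_drawEdge hw hv hj (by omega) hAW hW h3 h6 e10 e18 e22 e23 h₃).mono le_rfl ?_
        rintro l'' ρ' m' ⟨⟨f10, f18, f22, f23⟩, hl'', h₄⟩
        exact ⟨f18, f22, ⟨f10, f23⟩, by omega, h₄⟩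
      · exact ⟨⟨g10, g23⟩, rfl, h₂⟩
      · rintro l' ρ' m' ⟨-, ⟨f10, -⟩, hl', h₄⟩
        exact ⟨f10, (h₄.1.1 0 (by omega)).trans h0, by rw [Finset.sum_range_succ]; omega, h₄⟩
    exact (key.seq_pure hloop).mono (by omega) fun _ _ _ h => h
  · refine ⟨by simp, ⟨Frame.refl _ _, h8, rfl, h7⟩, by simp, ?_⟩
    funext x
    simp [layout]

theorem runs_startProg {K : ℕ} {l : List ℕ} (hn : 1 ≤ n) (hb : PeelBounds n K l B W A)
    (hρ : PeelRegs n K l ρ) :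
    Runs I W A startProg (n * 15 + 10) (PMF.pure ())
      (fun _ ρ' m' => Frame 10 ρ ρ' ∧ PeelState n K l 0 ρ' m') ρ
      (layout n (fun _ => 0) (fun _ => 0) (fun _ => 0) l) := by
  have h₁ := hb.nodes
  have h₂ := hb.le_word
  have h₃ := hb.addr
  have key : Runs I W A (forLoop 18 0 19 (block [.const 20 1, .store 18 20, .op .add 21 0 18,
      .store 21 20])) (n * 15 + 6) (PMF.pure ()) (fun _ ρ' m' => ρ' 0 = n ∧ Frame 10 ρ ρ' ∧
        m' = layout n (mix n (fun _ => 1) fun _ => 0) (mix n (fun _ => 1) fun _ => 0)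
          (fun _ => 0) l) ρ (layout n (fun _ => 0) (fun _ => 0) (fun _ => 0) l) := by
    refine Runs.forLoop_pure (τ := 7) (Inv := fun j ρ' m' => Frame 10 ρ ρ' ∧
      m' = layout n (mix j (fun _ => 1) fun _ => 0) (mix j (fun _ => 1) fun _ => 0)
        (fun _ => 0) l)
      (by decide) (by decide) (by decide) (by omega) (by omega) hρ.r0 ?_ ?_ ?_
    · intro j ρ' m' x y h
      simpa [frame_update] using h
    · rintro j hj ρ' m' h18 h0 ⟨hF, rfl⟩
      have hmix := update_mix j (fun _ => 1) fun _ => 0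
      refine Runs.straight (by omega) (by omega) (by simp [block, Prog.cost]) ?_
      simp [block, wp, h18, h0, hF, frame_update, update_layout_out hj,
        update_layout_alive hj.le, hmix]
      omega
    · exact ⟨Frame.refl _ _, rfl⟩
  refine (key.seq_pure (t₂ := 3) ?_).mono (by omega) fun _ _ _ h => h
  rintro ρ' m' ⟨-, hF, rfl⟩
  refine Runs.straight (by omega) (by omega) (by simp [block, Prog.cost]) ?_
  simp [block, wp, frame_update, hF, PeelState]
  refine ⟨by omega, Finset.range n, fun _ => 0, rfl, ?_, layout_congr ?_ ?_ ?_⟩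
  · exact
    { subset := subset_rfl
      nonempty := Finset.nonempty_range_iff.2 (by omega)
      pos := one_pos
      attained := by simp
      best := by simp
      le_length := Nat.zero_le _
      le_nodes := hn }
  · intro v hv
    simp [mix, ind, hv]
  · intro v hv
    simp [mix, ind, survivors]
  · exact fun _ _ => rfl

/-- The specification of the program: it stops with an approximately best set for the sample. -/
theorem runs_mainProg {M k : ℕ} (hn : 1 ≤ n) (hk : 1 ≤ k) (hM : 16 ≤ M)
    {q w : ℕ} (hq : q = M * n.size * k * k * n) (hw : w = sampleWidth I q)
    (hB : 3 * n + 2 + 2 * sampleSize I w ≤ B) (hqB : 16 * k + 1 + q ≤ B) (hwB : w ≤ B)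
    (hW : B * B * B ≤ W) (hA : A = 3 * n + 2 + sampleSize I w) (h0 : ρ 0 = n) (h1 : ρ 1 = k) :
    Runs I W A (mainProg M)
      (n.size * 4 + n * 60 + sampleSize I w * 25 +
        16 * k * n.size * (n * 55 + sampleSize I w * 43 + 62) + 100) (sample I w)
      (fun l ρ' m' => ∃ O a d x s, Best n (16 * k) l (16 * k * n.size) O x s ∧
        ρ' 0 = x * w * (16 * k) ∧ ρ' 1 = 2 * (s * (16 * k + 1)) ∧ m' = layout n (ind O) a d l)
      ρ (fun _ => 0) := by
  have hw₀ : 0 < w := hw ▸ sampleWidth_pos q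
  have hℓ : 1 ≤ n.size := Nat.size_pos.2 hn
  have b₁ : B * B * 2 ≤ B * B * B := Nat.mul_le_mul_left _ (by omega)
  have b₂ : B * 2 ≤ B * B := Nat.mul_le_mul_left _ (by omega)
  have b₃ := Nat.mul_le_mul (show n ≤ B by omega) (show n ≤ B by omega)
  obtain ⟨R, hR⟩ : ∃ R, R = 16 * k * n.size := ⟨_, rfl⟩
  have hRq : R ≤ q := by
    have a₁ : R ≤ M * n.size * k := by
      rw [hR, mul_right_comm]
      exact Nat.mul_le_mul_right _ (Nat.mul_le_mul_right _ hM)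
    have a₃ : M * n.size * k ≤ M * n.size * k * k := Nat.le_mul_of_pos_right _ hk
    have a₄ : M * n.size * k * k ≤ M * n.size * k * k * n := Nat.le_mul_of_pos_right _ hn
    omega
  obtain ⟨J, hJ⟩ : ∃ J, J = sampleSize I w := ⟨_, rfl⟩
  rw [← hR, ← hJ]
  rw [← hJ] at hB hA
  obtain ⟨T, hT⟩ : ∃ T, T = R * (n * 55 + J * 43 + 62) := ⟨_, rfl⟩
  rw [← hT]
  refine ((runs_sizeProg (by omega) h0).seq_pure (t₂ := n * 60 + J * 25 + T + 90) ?_).mono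
    (by omega) fun _ _ _ h => h
  rintro ρ₁ _ ⟨⟨h0, h1', h2⟩, rfl⟩
  rw [h1] at h1'
  refine ((runs_totalDegreeProg (by omega) h0).seq_pure (t₂ := n * 49 + J * 25 + T + 81) ?_).mono
    (by omega) fun _ _ _ h => h
  rintro ρ₂ _ ⟨⟨hF, h3⟩, rfl⟩
  refine ((runs_paramProg hn hk hℓ hM (B := B) (by omega) (by omega) (by omega)
    ((hF 0 (by omega)).trans h0) ((hF 1 (by omega)).trans h1') ((hF 2 (by omega)).trans h2)
    h3).seq_pure (t₂ := n * 49 + J * 25 + T + 47) ?_).mono (by omega) fun _ _ _ h => h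
  rintro ρ₃ _ ⟨⟨h0, h3, h4, h5, h6, h7, h8, h9⟩, rfl⟩
  rw [← hq, ← hw] at h3
  rw [← hR] at h9
  refine ((runs_sampleProg hw₀ (by omega) (by omega) (by omega) h0 h3 h6 h7 h8).seq_ret
    (t₂ := n * 15 + T + 39) ?_).mono (by omega) fun _ _ _ h => h
  rintro l ρ₄ _ ⟨hl, ⟨hF, g8, g9, g7⟩, hc, rfl⟩
  rw [← hJ] at hl
  have hb : PeelBounds n (16 * k) l B W A :=
    { nodes := by omega
      acc := by omega
      word := hW
      addr := by omega
      code := hc }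
  have hρ : PeelRegs n (16 * k) l ρ₄ :=
    { r0 := (hF 0 (by omega)).trans h0
      r4 := (hF 4 (by omega)).trans h4
      r5 := (hF 5 (by omega)).trans h5
      r6 := (hF 6 (by omega)).trans h6
      r7 := g7
      r8 := g8 }
  have k3 : ρ₄ 3 = w := (hF 3 (by omega)).trans h3
  rw [h9] at g9
  suffices Runs I W A (block [startProg, forLoop 10 9 17 roundProg, outputProg])
      (n * 15 + T + 39) (PMF.pure ()) (fun _ ρ' m' => ∃ O a d x s,
        Best n (16 * k) l R O x s ∧ ρ' 0 = x * w * (16 * k) ∧ ρ' 1 = 2 * (s * (16 * k + 1)) ∧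
          m' = layout n (ind O) a d l) ρ₄ (layout n (fun _ => 0) (fun _ => 0) (fun _ => 0) l) from
    (this.ghost (b := l)).pure_eq.mono le_rfl fun _ _ _ h => h.1 ▸ h.2
  refine ((runs_startProg hn hb hρ).seq_pure (t₂ := T + 28) ?_).mono (by omega) fun _ _ _ h => h
  rintro ρ₅ m₅ ⟨hF₅, h₅⟩
  have hloop : Runs I W A (forLoop 10 9 17 roundProg) (R * (n * 55 + J * 43 + 54 + 8) + 6)
      (PMF.pure ()) (fun _ ρ' m' => ρ' 9 = R ∧ Frame 9 ρ₄ ρ' ∧ PeelState n (16 * k) l R ρ' m')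
      ρ₅ m₅ := by
    refine Runs.forLoop_pure (Inv := fun i ρ' m' => Frame 9 ρ₄ ρ' ∧
      PeelState n (16 * k) l i ρ' m') (by decide) (by decide) (by decide) (by omega) (by omega)
      ((hF₅ 9 (by omega)).trans g9) ?_ ?_ ⟨hF₅.mono (by omega), h₅⟩
    · intro j ρ' m' x y h
      simpa [frame_update, PeelState] using h
    · rintro i hi ρ' m' e10 e9 ⟨hF', h'⟩
      refine (runs_roundProg hb (hρ.frame le_rfl hF') h').mono (by omega) ?_
      rintro - ρ'' m'' ⟨hF'', h''⟩
      exact ⟨(hF'' 10 (by omega)).trans e10, (hF'' 9 (by omega)).trans e9,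
        hF'.trans (hF''.mono (by omega)), h''⟩
  have hT' : R * (n * 55 + J * 43 + 54 + 8) = T := hT.symm
  rw [hT'] at hloop
  refine (hloop.seq_pure (t₂ := 11) ?_).mono (by omega) fun _ _ _ h => h
  rintro ρ₆ _ ⟨-, hF₆, O, d, -, hO, rfl⟩
  have e3 := (hF₆ 3 (by omega)).trans k3
  have e4 := (hF₆ 4 (by omega)).trans hρ.r4
  have hx := hO.le_length
  have hs := hO.le_nodes
  have c₁ : ρ₆ 11 * w ≤ B * B := Nat.mul_le_mul (by omega) hwB
  have c₂ : ρ₆ 11 * w * (16 * k) ≤ B * B * B := Nat.mul_le_mul c₁ (by omega)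
  have c₃ : ρ₆ 12 * (16 * k + 1) ≤ B * B := Nat.mul_le_mul (by omega) (by omega)
  refine Runs.straight (by omega) (by omega) (by simp [block, outputProg, Prog.cost]) ?_
  simp only [block, outputProg, wp, e3, e4, Function.update_apply,
    Nat.reduceEqDiff, if_true, if_false]
  simp
  refine ⟨by omega, by omega, by omega, by omega, by omega, by omega, O, _, _, ρ₆ 11,
    ρ₆ 12, hO, Or.inl (Or.inl rfl), by omega, rfl⟩

end Sample

/-! ### Peeling finds a dense set -/

section Peeling

variable {n K : ℕ} {l : List ℕ}

theorem inside_mono {S T : Finset ℕ} (h : S ⊆ T) (c : ℕ) : inside n S c ≤ inside n T c := by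
  have h' : ∀ v, ind S v ≤ ind T v := fun v => by
    by_cases hv : v ∈ S
    · rw [ind_eq_one hv, ind_eq_one (h hv)]
    · rw [ind_eq_zero hv]; exact Nat.zero_le _
  exact Nat.mul_le_mul (h' _) (h' _)

theorem degIn_mono {S T : Finset ℕ} (h : S ⊆ T) (v : ℕ) : degIn n l S v ≤ degIn n l T v :=
  List.sum_le_sum fun c _ => Nat.mul_le_mul_right _ (inside_mono h c)

/-- Equality fails in general because `T` need not contain all nodes of the pairs. -/
theorem sum_degIn_le (S T : Finset ℕ) : ∑ v ∈ T, degIn n l S v ≤ 2 * edgeCount n l S := by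
  induction l with
  | nil => simp [degIn]
  | cons c l ih =>
    have h₁ : ∑ v ∈ T, incidence n v c ≤ 2 := by
      simp only [incidence, Finset.sum_add_distrib, Finset.sum_ite_eq']
      split_ifs <;> simp
    have h₂ := Nat.mul_le_mul_left (inside n S c) h₁
    rw [Finset.mul_sum] at h₂
    simp only [degIn, edgeCount, List.map_cons, List.sum_cons, Finset.sum_add_distrib] at ih ⊢
    omega

/-- Removing a node destroys at most as many pairs as its degree; the inequality may be strict because
a pair `(v, v)` counts twice in the degree. -/
theorem edgeCount_le_erase_add (S : Finset ℕ) (v : ℕ) :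
    edgeCount n l S ≤ edgeCount n l (S.erase v) + degIn n l S v := by
  rw [edgeCount, edgeCount, degIn, ← List.sum_map_add]
  refine List.sum_le_sum fun c _ => ?_
  by_cases h : v = c / (n + 1) ∨ v = c % (n + 1)
  · have : 1 ≤ incidence n v c := by
      unfold incidence
      rcases h with h | h <;> simp [← h]
    have := Nat.le_mul_of_pos_right (inside n S c) this
    omega
  · push Not at h
    have : inside n S c = inside n (S.erase v) c := by
      simp [inside, ind, Ne.symm h.1, Ne.symm h.2]
    omega

/-- The surviving nodes have more than `1 + 1 / K` times the average degree. -/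
theorem card_peel_le (S : Finset ℕ) : (peel n K l S).card * (K + 1) ≤ S.card * K := by
  -- The removal threshold is not strict, so without edges all nodes are removed.
  rcases Nat.eq_zero_or_pos (edgeCount n l S) with h | h
  · have : peel n K l S = ∅ := by
      refine Finset.filter_eq_empty_iff.2 fun v _ => ?_
      have := sum_degIn_le (n := n) (l := l) S {v}
      rw [Finset.sum_singleton, h] at this
      simp [Nat.le_zero.1 this]
    simp [this]
  · have h₁ : (peel n K l S).card * (2 * ((K + 1) * edgeCount n l S)) ≤
        ∑ v ∈ peel n K l S, degIn n l S v * (S.card * K) := by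
      rw [← smul_eq_mul]
      exact Finset.card_nsmul_le_sum _ _ _ fun v hv => (Finset.mem_filter.1 hv).2.le
    rw [← Finset.sum_mul] at h₁
    have h₂ := h₁.trans (Nat.mul_le_mul_right _ (sum_degIn_le S _))
    refine Nat.le_of_mul_le_mul_right (c := 2 * edgeCount n l S) ?_ (by omega)
    calc (peel n K l S).card * (K + 1) * (2 * edgeCount n l S)
        = (peel n K l S).card * (2 * ((K + 1) * edgeCount n l S)) := by ring
      _ ≤ _ := h₂
      _ = _ := by ring

theorem card_survivors_le (i : ℕ) : (survivors n K l i).card * (K + 1) ^ i ≤ n * K ^ i := by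
  induction i with
  | zero => simp [survivors]
  | succ i ih =>
    calc (survivors n K l (i + 1)).card * (K + 1) ^ (i + 1)
        = (peel n K l (survivors n K l i)).card * (K + 1) * (K + 1) ^ i := by
          rw [survivors]; ring
      _ ≤ (survivors n K l i).card * K * (K + 1) ^ i := Nat.mul_le_mul_right _ (card_peel_le _)
      _ = (survivors n K l i).card * (K + 1) ^ i * K := by ring
      _ ≤ n * K ^ i * K := Nat.mul_le_mul_right _ ih
      _ = n * K ^ (i + 1) := by ring

theorem two_mul_pow_le (hK : 1 ≤ K) : 2 * K ^ K ≤ (K + 1) ^ K := by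
  have h := one_add_mul_le_pow (a := (1 / K : ℝ))
    ((by norm_num : (-2 : ℝ) ≤ 0).trans (by positivity)) K
  have hK' : (0 : ℝ) < K := by exact_mod_cast hK
  have h' : (2 : ℝ) * K ^ K ≤ (K + 1) ^ K := by
    have e : (K + 1 : ℝ) ^ K = (1 + 1 / K) ^ K * K ^ K := by
      rw [← mul_pow]
      congr 1
      field_simp
    rw [e]
    refine mul_le_mul_of_nonneg_right ?_ (by positivity)
    rw [mul_one_div_cancel hK'.ne'] at h
    linarith
  exact_mod_cast h'

/-- Every round shrinks the set of survivors by the factor `1 + 1 / K`. -/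
theorem survivors_eq_empty {ℓ : ℕ} (hK : 1 ≤ K) (hn : n < 2 ^ ℓ) :
    survivors n K l (K * ℓ) = ∅ := by
  by_contra h
  have h₁ := Nat.mul_le_mul_right ((K + 1) ^ (K * ℓ))
    (Finset.card_pos.2 (Finset.nonempty_iff_ne_empty.2 h))
  have h₂ := h₁.trans (card_survivors_le (K * ℓ))
  have h₃ := Nat.pow_le_pow_left (two_mul_pow_le hK) ℓ
  rw [mul_pow, ← pow_mul, ← pow_mul] at h₃
  have h₄ : 2 ^ ℓ * K ^ (K * ℓ) ≤ n * K ^ (K * ℓ) := by omega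
  exact absurd (Nat.le_of_mul_le_mul_right h₄ (by positivity)) (by omega)

theorem exists_densest (n : ℕ) (l : List ℕ) (hn : 1 ≤ n) : ∃ S ⊆ Finset.range n, S.Nonempty ∧
    ∀ T ⊆ Finset.range n, edgeCount n l T * S.card ≤ edgeCount n l S * T.card := by
  obtain ⟨S, hS, hmax⟩ := Finset.exists_max_image
    ((Finset.range n).powerset.filter Finset.Nonempty)
    (fun S => (edgeCount n l S : ℚ) / S.card)
    ⟨Finset.range n, by simp; omega⟩
  simp only [Finset.mem_filter, Finset.mem_powerset] at hS hmax
  refine ⟨S, hS.1, hS.2, fun T hT => ?_⟩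
  rcases T.eq_empty_or_nonempty with rfl | hT'
  · simp [edgeCount_empty]
  · have h := hmax T ⟨hT, hT'⟩
    have h₁ : (0 : ℚ) < S.card := by exact_mod_cast hS.2.card_pos
    have h₂ : (0 : ℚ) < T.card := by exact_mod_cast hT'.card_pos
    rw [div_le_div_iff₀ h₂ h₁] at h
    exact_mod_cast h

/-- If peeling goes on until no node is left, then the best set has at least `1 / (2 (1 + 1 / K))`
times the maximum density: just before the first node `v` of a densest set `S` is removed, the
current set contains `S`, so that the degree of `v` is at least the density of `S`. -/
theorem Best.edgeCount_le {ℓ x s : ℕ} {O : Finset ℕ} (hn : 1 ≤ n) (hK : 1 ≤ K) (hℓ : n < 2 ^ ℓ)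
    (h : Best n K l (K * ℓ) O x s) {T : Finset ℕ} (hT : T ⊆ Finset.range n) :
    edgeCount n l T * (K * s) ≤ 2 * ((K + 1) * x) * T.card := by
  obtain ⟨S, hS, hne, hmax⟩ := exists_densest n l hn
  have hdeg : ∀ v ∈ S, edgeCount n l S ≤ S.card * degIn n l S v := by
    intro v hv
    have h₁ := hmax (S.erase v) ((Finset.erase_subset _ _).trans hS)
    have h₂ := Nat.mul_le_mul_right S.card (edgeCount_le_erase_add (n := n) (l := l) S v)
    have h₃ := Finset.card_erase_add_one hv
    have h₄ : edgeCount n l S * S.card =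
        edgeCount n l S * (S.erase v).card + edgeCount n l S := by
      rw [← h₃]; ring
    rw [add_mul] at h₂
    rw [mul_comm S.card]
    omega
  obtain ⟨i, hi, hSi, hSi'⟩ : ∃ i < K * ℓ, S ⊆ survivors n K l i ∧
      ¬ S ⊆ survivors n K l (i + 1) := by
    by_contra! hcon
    have : ∀ i ≤ K * ℓ, S ⊆ survivors n K l i := by
      intro i
      induction i with
      | zero => exact fun _ => hS
      | succ i ih => exact fun hi => hcon i (by omega) (ih (by omega))
    have := this _ le_rfl
    rw [survivors_eq_empty hK hℓ, Finset.subset_empty] at this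
    exact hne.ne_empty this
  obtain ⟨v, hv, hv'⟩ := Finset.not_subset.1 hSi'
  have h₁ : degIn n l (survivors n K l i) v * ((survivors n K l i).card * K) ≤
      2 * ((K + 1) * edgeCount n l (survivors n K l i)) := by
    by_contra! h'
    exact hv' (Finset.mem_filter.2 ⟨hSi hv, h'⟩)
  have h₂ := (hdeg v hv).trans (Nat.mul_le_mul_left _ (degIn_mono hSi v))
  have hpos : 0 < (survivors n K l i).card * S.card :=
    Nat.mul_pos (Finset.card_pos.2 ⟨v, hSi hv⟩) hne.card_pos
  refine Nat.le_of_mul_le_mul_right (c := (survivors n K l i).card * S.card) ?_ hpos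
  calc edgeCount n l T * (K * s) * ((survivors n K l i).card * S.card)
      = edgeCount n l T * S.card * ((survivors n K l i).card * K * s) := by ring
    _ ≤ edgeCount n l S * T.card * ((survivors n K l i).card * K * s) :=
        Nat.mul_le_mul_right _ (hmax T hT)
    _ = edgeCount n l S * (T.card * ((survivors n K l i).card * K * s)) := by ring
    _ ≤ S.card * degIn n l (survivors n K l i) v * (T.card * ((survivors n K l i).card * K * s)) :=
        Nat.mul_le_mul_right _ h₂
    _ = degIn n l (survivors n K l i) v * ((survivors n K l i).card * K) *
          (S.card * T.card * s) := by ring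
    _ ≤ 2 * ((K + 1) * edgeCount n l (survivors n K l i)) * (S.card * T.card * s) :=
        Nat.mul_le_mul_right _ h₁
    _ = edgeCount n l (survivors n K l i) * s * (2 * (K + 1) * S.card * T.card) := by ring
    _ ≤ x * (survivors n K l i).card * (2 * (K + 1) * S.card * T.card) :=
        Nat.mul_le_mul_right _ (h.best i hi)
    _ = _ := by ring

end Peeling

/-! ### Counting edges in incidence lists -/

section Slots

variable {n : ℕ} {G : SimpleGraph (Fin n)} (I : IncidenceList G)

/-- The number of entries of incidence lists of nodes in `S` that belong to `S`. -/
def slots (S : Finset ℕ) : ℕ :=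
  ∑ v ∈ Finset.range n, ∑ i ∈ Finset.range (I.degreeQuery v), ind S v * ind S (I.neighborQuery v i)

/-- The set of edges of `G` with both endpoints in `T`. -/
def edgesWithin (G : SimpleGraph (Fin n)) (T : Finset (Fin n)) : Set (Sym2 (Fin n)) :=
  {e ∈ G.edgeSet | ∀ v ∈ e, v ∈ T}

variable {I}

theorem sum_neighbors (v : Fin n) (f : ℕ → ℕ) :
    ∑ i ∈ Finset.range (I.degreeQuery v), f (I.neighborQuery v i) =
      ∑ u : Fin n, if u ∈ I.nbrs v then f u else 0 := by
  have h₁ : I.degreeQuery v = (I.nbrs v).length := by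
    simp [IncidenceList.degreeQuery]
  rw [h₁, Finset.sum_range]
  have h₂ : ∀ i : Fin (I.nbrs v).length, f (I.neighborQuery v i) = f ((I.nbrs v)[i.1] : Fin n) := by
    intro i
    simp [IncidenceList.neighborQuery]
  simp only [h₂]
  rw [Fin.sum_univ_fun_getElem (I.nbrs v) fun u : Fin n => f u,
    ← List.sum_toFinset _ (I.nodup v), ← Finset.sum_filter]
  refine Finset.sum_congr ?_ fun _ _ => rfl
  ext u
  simp

theorem ind_map_val (T : Finset (Fin n)) (v : Fin n) :
    ind (T.map Fin.valEmbedding) v = if v ∈ T then 1 else 0 := by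
  unfold ind
  congr 1
  simp [Fin.val_inj]

/-- Every edge within `T` occupies two slots. -/
theorem slots_eq (T : Finset (Fin n)) :
    slots I (T.map Fin.valEmbedding) = 2 * (edgesWithin G T).ncard := by
  classical
  let H : SimpleGraph (Fin n) :=
    { Adj := fun u v => G.Adj u v ∧ u ∈ T ∧ v ∈ T
      symm := ⟨fun u v h => ⟨h.1.symm, h.2.2, h.2.1⟩⟩
      loopless := ⟨fun u h => h.1.ne rfl⟩ }
  have hE : edgesWithin G T = H.edgeSet := by
    ext e
    induction e using Sym2.ind with
    | _ u v => simp [edgesWithin, H]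
  rw [hE, ← SimpleGraph.coe_edgeFinset, Set.ncard_coe_finset,
    ← SimpleGraph.sum_degrees_eq_twice_card_edges, slots, Finset.sum_range]
  refine Finset.sum_congr rfl fun v _ => ?_
  rw [← Finset.mul_sum, sum_neighbors, ind_map_val, ← SimpleGraph.card_neighborFinset_eq_degree,
    Finset.card_eq_sum_ones, SimpleGraph.neighborFinset_eq_filter, Finset.sum_filter,
    Finset.mul_sum]
  refine Finset.sum_congr rfl fun u _ => ?_
  rw [ind_map_val]
  simp only [H, I.mem_iff]
  by_cases h₁ : v ∈ T <;> by_cases h₂ : u ∈ T <;> by_cases h₃ : G.Adj v u <;> simp [h₁, h₂, h₃]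

theorem neighborQuery_of_le {v i : ℕ} (h : I.degreeQuery v ≤ i) : I.neighborQuery v i = n := by
  unfold IncidenceList.neighborQuery IncidenceList.degreeQuery at *
  split_ifs at h ⊢ <;> first | rfl | omega

theorem sum_range_mul (f : ℕ → ℕ) (a w : ℕ) :
    ∑ j ∈ Finset.range a, ∑ x ∈ Finset.range w, f (j * w + x) =
      ∑ i ∈ Finset.range (a * w), f i := by
  induction a with
  | zero => simp
  | succ a ih => rw [Finset.sum_range_succ, ih, Nat.succ_mul, Finset.sum_range_add]

/-- The slots in which `S` can be hit by the random draws, interval by interval. -/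
theorem slots_eq_sum_intervals {S : Finset ℕ} (hS : S ⊆ Finset.range n) {w : ℕ} (hw : 0 < w) :
    slots I S = ∑ v ∈ Finset.range n, ∑ j ∈ Finset.range (intervals I w v),
      ∑ x ∈ Finset.range w, ind S v * ind S (I.neighborQuery v (j * w + x)) := by
  refine Finset.sum_congr rfl fun v _ => ?_
  rw [sum_range_mul fun i => ind S v * ind S (I.neighborQuery v i)]
  refine Finset.sum_subset (Finset.range_subset_range.2 ?_) fun i _ hi => ?_
  · have h₁ := Nat.lt_div_mul_add (a := I.degreeQuery v + w - 1) hw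
    rw [intervals]
    omega
  · rw [neighborQuery_of_le (by simpa using hi), ind_eq_zero (v := n) fun h => by simpa using hS h,
      mul_zero]

theorem totalDegree_eq :
    I.totalDegree = slots I ((Finset.univ : Finset (Fin n)).map Fin.valEmbedding) := by
  refine Finset.sum_congr rfl fun v hv => ?_
  have hv' := Finset.mem_range.1 hv
  lift v to Fin n using hv'
  rw [← Finset.mul_sum, sum_neighbors, ind_map_val]
  have h := sum_neighbors (I := I) v fun _ => 1
  simp only [ind_map_val, Finset.mem_univ, if_true, one_mul]
  simpa using h

end Slots

/-! ### Expectations -/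

section Expect

variable {α β : Type}

/-- The expectation of a nonnegative function. -/
noncomputable def expect (μ : PMF α) (f : α → ℝ≥0∞) : ℝ≥0∞ := ∑' a, μ a * f a

theorem expect_pure (a : α) (f : α → ℝ≥0∞) : expect (PMF.pure a) f = f a := by
  classical
  rw [expect, tsum_eq_single a fun b hb => by simp [PMF.pure_apply_of_ne _ _ hb]]
  simp

theorem expect_bind (μ : PMF α) (κ : α → PMF β) (f : β → ℝ≥0∞) :
    expect (μ.bind κ) f = expect μ fun a => expect (κ a) f := by
  simp only [expect, PMF.bind_apply, ← ENNReal.tsum_mul_right, ← ENNReal.tsum_mul_left]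
  rw [ENNReal.tsum_comm]
  simp only [mul_assoc]

theorem expect_map (μ : PMF α) (g : α → β) (f : β → ℝ≥0∞) :
    expect (μ.map g) f = expect μ (f ∘ g) := by
  rw [PMF.map, expect_bind]
  simp only [Function.comp_apply, expect_pure]
  rfl

theorem expect_mono {μ : PMF α} {f g : α → ℝ≥0∞} (h : ∀ a, f a ≤ g a) :
    expect μ f ≤ expect μ g :=
  ENNReal.tsum_le_tsum fun a => mul_le_mul_right (h a) _

theorem expect_mul_const (μ : PMF α) (f : α → ℝ≥0∞) (c : ℝ≥0∞) :
    (expect μ fun a => f a * c) = expect μ f * c := by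
  simp only [expect, ← mul_assoc, ENNReal.tsum_mul_right]

/-- Markov's inequality. -/
theorem toOuterMeasure_le_expect (μ : PMF α) (s : Set α) (f : α → ℝ≥0∞) (h : ∀ a ∈ s, 1 ≤ f a) :
    μ.toOuterMeasure s ≤ expect μ f := by
  classical
  rw [PMF.toOuterMeasure_apply]
  refine ENNReal.tsum_le_tsum fun a => ?_
  rw [Set.indicator_apply]
  split_ifs with ha
  · exact le_mul_of_one_le_right' (h a ha)
  · exact bot_le

theorem expect_uniformBelow {w : ℕ} (hw : 0 < w) (f : ℕ → ℝ≥0∞) :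
    expect (uniformBelow w) f = ∑ x ∈ Finset.range w, (w : ℝ≥0∞)⁻¹ * f x := by
  have hne : (Finset.range w).Nonempty := Finset.nonempty_range_iff.2 hw.ne'
  have h : uniformBelow w = PMF.uniformOfFinset (Finset.range w) hne := dif_pos hw
  rw [expect, h, tsum_eq_sum (s := Finset.range w)]
  · refine Finset.sum_congr rfl fun x hx => ?_
    rw [PMF.uniformOfFinset_apply_of_mem _ hx, Finset.card_range]
  · intro x hx
    rw [PMF.uniformOfFinset_apply_of_notMem _ hx, zero_mul]

/-- If the expectation of `f` grows at most by the factor `g i` in the transition `κ i`, then the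
factors multiply. -/
theorem expect_iterate_le {κ : ℕ → α → PMF α} {f : α → ℝ≥0∞} {g : ℕ → ℝ≥0∞}
    (h : ∀ i a, expect (κ i a) f ≤ f a * g i) (i N : ℕ) (a : α) :
    expect (iterate κ i N a) f ≤ f a * ∏ j ∈ Finset.range N, g (i + j) := by
  induction N generalizing i a with
  | zero => simp [iterate, expect_pure]
  | succ N ih =>
    rw [iterate, expect_bind, Finset.prod_range_succ']
    calc (expect (κ i a) fun a => expect (iterate κ (i + 1) N a) f)
        ≤ expect (κ i a) fun a => f a * ∏ j ∈ Finset.range N, g (i + 1 + j) :=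
          expect_mono fun a => ih (i + 1) a
      _ = expect (κ i a) f * ∏ j ∈ Finset.range N, g (i + 1 + j) := expect_mul_const _ _ _
      _ ≤ f a * g i * ∏ j ∈ Finset.range N, g (i + 1 + j) := mul_le_mul_left (h i a) _
      _ = _ := by
        rw [mul_assoc, mul_comm (g i)]
        simp only [add_assoc, add_comm 1, add_zero]

/-- If the transition `κ i` surely increases `f` by `h i`, then the increments add up. -/
theorem iterate_support {κ : ℕ → α → PMF α} {f : α → ℕ} {h : ℕ → ℕ}
    (hκ : ∀ i a, ∀ b ∈ (κ i a).support, f b = f a + h i) (i N : ℕ) (a : α) :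
    ∀ b ∈ (iterate κ i N a).support, f b = f a + ∑ j ∈ Finset.range N, h (i + j) := by
  induction N generalizing i a with
  | zero => simp [iterate]
  | succ N ih =>
    intro b hb
    rw [iterate, PMF.mem_support_bind_iff] at hb
    obtain ⟨c, hc, hb⟩ := hb
    rw [ih (i + 1) c b hb, hκ i a c hc, Finset.sum_range_succ']
    simp only [add_assoc, add_comm 1, add_zero]
    rw [add_comm (h i)]

end Expect

/-! ### Concentration of the sample -/

section Concentration

variable {n : ℕ} {G : SimpleGraph (Fin n)} {I : IncidenceList G} {S : Finset ℕ} {w : ℕ}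

theorem edgeCount_append_pair (l : List ℕ) (v i : ℕ) :
    edgeCount n (l ++ [v * (n + 1) + I.neighborQuery v i]) S =
      edgeCount n l S + ind S v * ind S (I.neighborQuery v i) := by
  have hu := I.neighborQuery_le v i
  rw [edgeCount_append]
  simp only [edgeCount, List.map_cons, List.map_nil, List.sum_cons, List.sum_nil, add_zero, inside]
  rw [Nat.mul_comm v, Nat.mul_add_div (by omega), Nat.div_eq_of_lt (by omega), Nat.mul_add_mod,
    Nat.mod_eq_of_lt (by omega), add_zero]

/-- With intervals of length `1` the sample contains every entry of every incidence list. -/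
theorem edgeCount_sample_one (hS : S ⊆ Finset.range n) {l : List ℕ}
    (hl : l ∈ (sample I 1).support) : edgeCount n l S = slots I S := by
  have h₁ : ∀ v j l, ∀ l' ∈ (drawEdge I 1 v j l).support, edgeCount n l' S =
      edgeCount n l S + ∑ x ∈ Finset.range 1, ind S v * ind S (I.neighborQuery v (j * 1 + x)) := by
    intro v j l l' hl'
    obtain ⟨x, hx, rfl⟩ := (PMF.mem_support_map_iff _ _ _).1 hl'
    rw [uniformBelow, dif_pos one_pos] at hx
    have hx' : x = 0 := by
      simpa using (PMF.mem_support_uniformOfFinset_iff _ _).1 hx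
    rw [edgeCount_append_pair, hx', Finset.sum_range_one]
  have h₂ := iterate_support (f := fun l => edgeCount n l S)
    (fun v l => iterate_support (f := fun l => edgeCount n l S) (h₁ v) 0
      (intervals I 1 v) l) 0 n [] l hl
  rw [slots_eq_sum_intervals hS one_pos]
  simpa [edgeCount] using h₂

theorem exp_mul_le {t : ℝ} {x : ℕ} (hx : x ≤ 1) :
    Real.exp (t * x) = 1 + (Real.exp t - 1) * x := by
  interval_cases x <;> simp

/-- One draw hits `S` with some probability `p`, and `1 + p (exp t - 1) ≤ exp (p (exp t - 1))`. The
shift `τ` is there for the use with Markov's inequality. -/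
theorem expect_drawEdge_le (hw : 0 < w) (t τ : ℝ) (v j : ℕ) (l : List ℕ) :
    expect (drawEdge I w v j l) (fun l => ENNReal.ofReal (Real.exp (t * edgeCount n l S - τ))) ≤
      ENNReal.ofReal (Real.exp (t * edgeCount n l S - τ)) * ENNReal.ofReal (Real.exp
        ((Real.exp t - 1) / w * (∑ x ∈ Finset.range w,
          ind S v * ind S (I.neighborQuery v (j * w + x)) : ℕ))) := by
  have hw' : (0 : ℝ) < w := by exact_mod_cast hw
  rw [drawEdge, expect_map, expect_uniformBelow hw, ← ENNReal.ofReal_mul (Real.exp_pos _).le]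
  have h₁ : ∀ x, (w : ℝ≥0∞)⁻¹ * ((fun l => ENNReal.ofReal (Real.exp (t * edgeCount n l S - τ))) ∘
      fun x => l ++ [v * (n + 1) + I.neighborQuery v (j * w + x)]) x =
      ENNReal.ofReal (Real.exp (t * edgeCount n l S - τ) * ((w : ℝ)⁻¹ * (1 + (Real.exp t - 1) *
        (ind S v * ind S (I.neighborQuery v (j * w + x)) : ℕ)))) := by
    intro x
    rw [← exp_mul_le (Nat.mul_le_mul (ind_le _ _) (ind_le _ _)), Function.comp_apply,
      edgeCount_append_pair, ← ENNReal.ofReal_natCast w, ← ENNReal.ofReal_inv_of_pos hw',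
      ← ENNReal.ofReal_mul (by positivity)]
    congr 1
    rw [mul_left_comm, ← Real.exp_add]
    push_cast
    ring_nf
  rw [Finset.sum_congr rfl fun x _ => h₁ x, ← ENNReal.ofReal_sum_of_nonneg]
  · refine ENNReal.ofReal_le_ofReal ?_
    rw [← Finset.mul_sum, ← Finset.mul_sum, Finset.sum_add_distrib, ← Finset.mul_sum]
    refine mul_le_mul_of_nonneg_left ?_ (Real.exp_pos _).le
    refine le_trans (le_of_eq ?_) (Real.add_one_le_exp _)
    simp only [Finset.sum_const, Finset.card_range, nsmul_eq_mul, mul_one]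
    push_cast
    field_simp
    ring
  · intro x _
    rw [← exp_mul_le (Nat.mul_le_mul (ind_le _ _) (ind_le _ _))]
    positivity

/-- The moment generating function of the number of sampled pairs inside `S` is at most that of a
Poisson variable. -/
theorem expect_sample_le (hS : S ⊆ Finset.range n) (hw : 0 < w) (t τ : ℝ) :
    expect (sample I w) (fun l => ENNReal.ofReal (Real.exp (t * edgeCount n l S - τ))) ≤
      ENNReal.ofReal (Real.exp ((Real.exp t - 1) / w * slots I S - τ)) := by
  have h₁ := expect_iterate_le (fun v l => expect_iterate_le
    (fun j l => expect_drawEdge_le (I := I) (S := S) hw t τ v j l) 0 (intervals I w v) l) 0 n []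
  refine h₁.trans (le_of_eq ?_)
  simp only [← ENNReal.ofReal_prod_of_nonneg, Real.exp_nonneg, implies_true, zero_add,
    ← Real.exp_sum]
  rw [← ENNReal.ofReal_mul (Real.exp_nonneg _), ← Real.exp_add, slots_eq_sum_intervals hS hw]
  congr 2
  simp only [edgeCount, List.map_nil, List.sum_nil, Nat.cast_zero, mul_zero]
  push_cast
  simp only [Finset.mul_sum]
  ring

/-- A Chernoff bound, in which the upper bound `M` of the mean takes the place of the mean. -/
theorem deviation_le (hS : S ⊆ Finset.range n) (hw : 0 < w) {δ M : ℝ} (hδ : 0 ≤ δ) (hδ' : δ ≤ 1)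
    (hM : (slots I S : ℝ) / w ≤ M) :
    (sample I w).toOuterMeasure {l | δ * M < |(edgeCount n l S : ℝ) - slots I S / w|} ≤
      ENNReal.ofReal (2 * Real.exp (-(δ ^ 2 * M / 4))) := by
  obtain ⟨μ, hμ⟩ : ∃ μ : ℝ, μ = slots I S / w := ⟨_, rfl⟩
  have hμ0 : 0 ≤ μ := hμ ▸ by positivity
  rw [← hμ] at hM ⊢
  -- Both tails are bounded through the moment generating function at `t = ± δ / 2`.
  have hexp : ∀ t : ℝ, |t| = δ / 2 → Real.exp t - 1 ≤ t + δ ^ 2 / 4 := by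
    intro t ht
    have h₁ := Real.abs_exp_sub_one_sub_id_le (x := t) (by rw [ht]; linarith)
    rw [← sq_abs, ht] at h₁
    have := (abs_le.1 h₁).2
    nlinarith
  have side : ∀ t : ℝ, |t| = δ / 2 →
      (sample I w).toOuterMeasure {l | δ / 2 * (δ * M) ≤ t * (edgeCount n l S - μ)} ≤
        ENNReal.ofReal (Real.exp (-(δ ^ 2 * M / 4))) := by
    intro t ht
    refine (toOuterMeasure_le_expect _ _ (fun l => ENNReal.ofReal (Real.exp
      (t * edgeCount n l S - (t * μ + δ / 2 * (δ * M))))) ?_).trans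
      ((expect_sample_le hS hw t _).trans (ENNReal.ofReal_le_ofReal (Real.exp_le_exp.2 ?_)))
    · intro l hl
      rw [Set.mem_ofPred_eq] at hl
      rw [ENNReal.one_le_ofReal, Real.one_le_exp_iff]
      linarith
    · have h₁ := mul_le_mul_of_nonneg_right (hexp t ht) hμ0
      have h₂ : (Real.exp t - 1) / w * slots I S = (Real.exp t - 1) * μ := by
        rw [hμ]; ring
      have h₃ := mul_le_mul_of_nonneg_left hM (show 0 ≤ δ ^ 2 / 4 by positivity)
      rw [h₂]
      nlinarith
  have h₁ := side (δ / 2) (abs_of_nonneg (by positivity))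
  have h₂ := side (-(δ / 2)) (by rw [abs_neg, abs_of_nonneg (by positivity)])
  rw [two_mul, ENNReal.ofReal_add (Real.exp_nonneg _) (Real.exp_nonneg _)]
  refine le_trans ?_ (add_le_add h₁ h₂)
  refine le_trans (MeasureTheory.measure_mono fun l hl => ?_) (MeasureTheory.measure_union_le _ _)
  rw [Set.mem_ofPred_eq] at hl
  rcases lt_abs.1 hl with h | h
  · exact Or.inl (mul_le_mul_of_nonneg_left h.le (by positivity))
  · refine Or.inr ?_
    have := mul_le_mul_of_nonneg_left h.le (show 0 ≤ δ / 2 by positivity)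
    rw [Set.mem_ofPred_eq]
    linarith

/-- A union bound over all nonempty sets of nodes: a set of size `s` contributes `2 y ^ s`, and the sum
of these terms is `2 ((1 + y) ^ n - 1)`. -/
theorem exists_deviation_le (hw : 0 < w) {δ r y : ℝ} (hδ : 0 ≤ δ) (hδ' : δ ≤ 1)
    (hr : ∀ T : Finset (Fin n), (slots I (T.map Fin.valEmbedding) : ℝ) / w ≤ r * T.card)
    (hy : Real.exp (-(δ ^ 2 * r / 4)) ≤ y) (hny : n * y ≤ 1 / 2) :
    (sample I w).toOuterMeasure {l | ∃ T : Finset (Fin n), T.Nonempty ∧ δ * (r * T.card) <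
      |(edgeCount n l (T.map Fin.valEmbedding) : ℝ) - slots I (T.map Fin.valEmbedding) / w|} ≤
      ENNReal.ofReal (4 * (n * y)) := by
  classical
  have hy0 : 0 ≤ y := (Real.exp_nonneg _).trans hy
  have hset : {l | ∃ T : Finset (Fin n), T.Nonempty ∧ δ * (r * T.card) <
      |(edgeCount n l (T.map Fin.valEmbedding) : ℝ) - slots I (T.map Fin.valEmbedding) / w|} =
      ⋃ T ∈ (Finset.univ : Finset (Finset (Fin n))).erase ∅, {l | δ * (r * T.card) <
      |(edgeCount n l (T.map Fin.valEmbedding) : ℝ) - slots I (T.map Fin.valEmbedding) / w|} := by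
    ext l
    simp [Finset.nonempty_iff_ne_empty]
  rw [hset]
  refine (MeasureTheory.measure_biUnion_finset_le _ _).trans ?_
  have hterm : ∀ T ∈ (Finset.univ : Finset (Finset (Fin n))).erase ∅,
      (sample I w).toOuterMeasure {l | δ * (r * T.card) <
      |(edgeCount n l (T.map Fin.valEmbedding) : ℝ) - slots I (T.map Fin.valEmbedding) / w|} ≤
      ENNReal.ofReal (2 * y ^ T.card) := by
    intro T _
    refine (deviation_le (fun v hv => ?_) hw hδ hδ' (hr T)).trans
      (ENNReal.ofReal_le_ofReal (mul_le_mul_of_nonneg_left ?_ zero_le_two))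
    · obtain ⟨u, -, rfl⟩ := Finset.mem_map.1 hv
      exact Finset.mem_range.2 u.2
    · refine le_trans (le_of_eq ?_) (pow_le_pow_left₀ (Real.exp_nonneg _) hy _)
      rw [← Real.exp_nat_mul]
      congr 1
      ring
  refine (Finset.sum_le_sum hterm).trans ?_
  rw [← ENNReal.ofReal_sum_of_nonneg fun T _ => by positivity]
  refine ENNReal.ofReal_le_ofReal ?_
  have hsum := Finset.sum_pow_mul_eq_add_pow y 1 (Finset.univ : Finset (Fin n))
  simp only [one_pow, mul_one, Finset.powerset_univ, Finset.card_univ, Fintype.card_fin] at hsum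
  rw [← Finset.mul_sum]
  have herase := Finset.sum_erase_add (s := (Finset.univ : Finset (Finset (Fin n))))
    (fun T => y ^ T.card) (Finset.mem_univ ∅)
  simp only [Finset.card_empty, pow_zero] at herase
  have h₁ : (y + 1) ^ n ≤ Real.exp (n * y) := by
    rw [Real.exp_nat_mul]
    exact pow_le_pow_left₀ (by linarith) (Real.add_one_le_exp y) n
  -- Here `n y ≤ 1 / 2` is used.
  have h₂ : Real.exp (n * y) ≤ 1 + 2 * (n * y) := by
    have h0 : 0 ≤ n * y := by positivity
    have h₃ := Real.abs_exp_sub_one_sub_id_le (x := n * y) (by rw [abs_of_nonneg h0]; linarith)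
    have := (abs_le.1 h₃).2
    nlinarith
  linarith

end Concentration

/-! ### Correctness -/

section Correctness

variable {n : ℕ} {G : SimpleGraph (Fin n)} {I : IncidenceList G}

theorem ncard_edgesWithin_le (T : Finset (Fin n)) :
    ((edgesWithin G T).ncard : ℝ) ≤ maxDensity G * T.card := by
  rcases T.eq_empty_or_nonempty with rfl | hT
  · have : edgesWithin G ∅ = ∅ := by
      ext e
      induction e using Sym2.ind with
      | _ u v => exact iff_of_false (fun h => by simpa using h.2 u (Sym2.mem_mk_left u v)) (by simp)
    simp [this]
  · have h : density G T ≤ maxDensity G := le_ciSup (Set.finite_range _).bddAbove T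
    rwa [density, div_le_iff₀ (by exact_mod_cast hT.card_pos)] at h

theorem exists_maxDensity (hn : 1 ≤ n) : ∃ T : Finset (Fin n), T.Nonempty ∧
    ((edgesWithin G T).ncard : ℝ) = maxDensity G * T.card := by
  obtain ⟨T, hT⟩ := exists_eq_ciSup_of_finite (f := fun T : Finset (Fin n) => density G T)
  change density G T = maxDensity G at hT
  rcases T.eq_empty_or_nonempty with rfl | hne
  · have h0 : maxDensity G = 0 := by rw [← hT]; simp [density]
    have : Nonempty (Fin n) := ⟨⟨0, hn⟩⟩
    refine ⟨Finset.univ, Finset.univ_nonempty, le_antisymm (ncard_edgesWithin_le _) ?_⟩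
    rw [h0, zero_mul]
    positivity
  · refine ⟨T, hne, ?_⟩
    rw [← hT, density, div_mul_cancel₀]
    · rfl
    · exact_mod_cast hne.card_pos.ne'

theorem maxDensity_nonneg : 0 ≤ maxDensity G :=
  (show (0 : ℝ) ≤ density G ∅ by simp [density]).trans
    (le_ciSup (Set.finite_range (density G)).bddAbove ∅)

/-- For every set of nodes the edge count of the sample `l` differs from its expectation by at most `δ` times the expected
edge count of a set of the same size and of maximum density. -/
def Concentrated (I : IncidenceList G) (w : ℕ) (δ : ℝ) (l : List ℕ) : Prop :=
  ∀ T : Finset (Fin n), T.Nonempty →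
    |(edgeCount n l (T.map Fin.valEmbedding) : ℝ) - slots I (T.map Fin.valEmbedding) / w| ≤
      δ * (2 * maxDensity G / w * T.card)

theorem map_val_subset (T : Finset (Fin n)) : T.map Fin.valEmbedding ⊆ Finset.range n := by
  intro v hv
  obtain ⟨u, -, rfl⟩ := Finset.mem_map.1 hv
  exact Finset.mem_range.2 u.2

/-- The choice of `K`: if the density `y` found in the sample is at least `1 / (2 (1 + 1 / K))` times
`(1 - 1 / K) r`, and the density `p` of the corresponding set in the graph is at least
`y - r / K`, then `y` (scaled) and `p` are `(2 + ε)`-approximations of `r`. -/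
theorem approx_of_bounds {K r y p ε : ℝ} (hK : 16 ≤ K) (hKε : 16 ≤ ε * K) (hr : 0 ≤ r)
    (hy : 0 ≤ y) (hp : 0 ≤ p) (h₁ : (K - 1) * r ≤ 2 * (K + 1) * y) (h₂ : y ≤ p + r / K)
    (h₃ : p ≤ r) :
    r / (2 + ε) ≤ y * K / (K + 1) ∧ y * K / (K + 1) ≤ r ∧ r ≤ (2 + ε) * p := by
  have hK0 : 0 < K := by linarith
  have hε : 0 < ε := pos_of_mul_pos_left (by linarith) hK0.le
  have h₄ : y * K ≤ p * K + r := by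
    have h := mul_le_mul_of_nonneg_right h₂ hK0.le
    have h' : (p + r / K) * K = p * K + r := by field_simp
    linarith
  refine ⟨?_, ?_, ?_⟩
  · rw [div_le_div_iff₀ (by linarith) (by linarith)]
    have h₅ := mul_le_mul_of_nonneg_left hKε hy
    have h₆ := mul_le_mul_of_nonneg_right h₁ (show 0 ≤ 2 * K + 16 by linarith)
    have h₇ : 2 * (K + 1) * (K + 1) ≤ (K - 1) * (2 * K + 16) := by nlinarith
    have h₈ := mul_le_mul_of_nonneg_left h₇ hr
    have h₉ := mul_le_mul_of_nonneg_left (show y * (2 * K + 16) ≤ y * K * (2 + ε) by linarith)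
      (show 0 ≤ 2 * (K + 1) by linarith)
    refine le_of_mul_le_mul_left (a := 2 * (K + 1)) ?_ (by linarith)
    linarith
  · rw [div_le_iff₀ (by linarith)]
    have h₅ := mul_le_mul_of_nonneg_right h₃ hK0.le
    linarith
  · have h₅ : r * (K ^ 2 - 3 * K - 2) ≤ 2 * (K + 1) * (p * K) := by
      have h := mul_le_mul_of_nonneg_left h₄ (show 0 ≤ 2 * (K + 1) by linarith)
      have h' := mul_le_mul_of_nonneg_right h₁ hK0.le
      linarith
    have h₆ := mul_le_mul_of_nonneg_right h₅ (show 0 ≤ 2 * K + 16 by linarith)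
    have h₇ : 2 * (K + 1) * K ^ 2 ≤ (K ^ 2 - 3 * K - 2) * (2 * K + 16) := by nlinarith
    have h₈ := mul_le_mul_of_nonneg_left h₇ hr
    have h₉ := mul_le_mul_of_nonneg_left hKε hp
    have h₁₀ := mul_le_mul_of_nonneg_left (show p * (2 * K + 16) ≤ p * K * (2 + ε) by linarith)
      (show 0 ≤ 2 * (K + 1) * K by positivity)
    refine le_of_mul_le_mul_left (a := 2 * (K + 1) * K ^ 2) ?_ (by positivity)
    linarith

/-- On a concentrated sample the result of peeling is an approximate solution for the graph. -/
theorem Best.isApproxSolution {k w x s : ℕ} {l : List ℕ} {O : Finset ℕ} {a d : ℕ → ℕ} {ε : ℝ}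
    {st : State} (hn : 1 ≤ n) (hk : 1 ≤ k) (hε : 0 < ε) (hεk : 1 / ε ≤ k) (hw : 0 < w)
    (hl : Concentrated I w (1 / (16 * k : ℕ)) l)
    (hO : Best n (16 * k) l (16 * k * n.size) O x s) (h0 : st.reg 0 = x * w * (16 * k))
    (h1 : st.reg 1 = 2 * (s * (16 * k + 1))) (hm : st.mem = layout n (ind O) a d l) :
    IsApproxSolution G (2 + ε) st := by
  obtain ⟨K, hK⟩ : ∃ K, K = 16 * k := ⟨_, rfl⟩
  rw [← hK] at hl hO h0 h1
  have hT : (st.outSet n).map Fin.valEmbedding = O := by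
    ext v
    simp only [Finset.mem_map, State.outSet, Finset.mem_filter, Finset.mem_univ, true_and, hm,
      Fin.valEmbedding_apply]
    constructor
    · rintro ⟨u, hu, rfl⟩
      rw [layout_out u.2] at hu
      by_contra h
      exact hu (ind_eq_zero h)
    · intro hv
      have hv' := Finset.mem_range.1 (hO.subset hv)
      refine ⟨⟨v, hv'⟩, ?_, rfl⟩
      rw [layout_out hv', ind_eq_one hv]
      exact one_ne_zero
  obtain ⟨T, hTdef⟩ : ∃ T, T = st.outSet n := ⟨_, rfl⟩
  rw [IsApproxSolution, State.outValue, h0, h1, ← hTdef]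
  rw [← hTdef] at hT
  have hTne : T.Nonempty := by
    rw [← Finset.map_nonempty (f := Fin.valEmbedding), hT]
    exact hO.nonempty
  have hTcard : T.card = O.card := by rw [← hT, Finset.card_map]
  obtain ⟨S, hS, hSr⟩ := exists_maxDensity (G := G) hn
  have hbest := hO.edgeCount_le hn (by omega) (Nat.lt_size_self n) (map_val_subset S)
  rw [Finset.card_map] at hbest
  have hatt := hO.attained
  rw [← hT, Finset.card_map] at hatt
  have hcS := (abs_le.1 (hl S hS)).1
  have hcT := (abs_le.1 (hl T hTne)).2
  rw [slots_eq] at hcS hcT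
  -- Pass to real numbers, with `y` the density of the sample scaled to the density of the graph.
  have hsR : (0 : ℝ) < s := by exact_mod_cast hO.pos
  have hwR : (0 : ℝ) < w := by exact_mod_cast hw
  have hSR : (0 : ℝ) < S.card := by exact_mod_cast hS.card_pos
  have hTR : (0 : ℝ) < T.card := by exact_mod_cast hTne.card_pos
  have hkR : (1 : ℝ) ≤ k := by exact_mod_cast hk
  have hKR : (K : ℝ) = 16 * k := by rw [hK]; push_cast; ring
  have hK16 : (16 : ℝ) ≤ K := by linarith
  have hbest' : (edgeCount n l (S.map Fin.valEmbedding) : ℝ) * (K * s) ≤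
      2 * ((K + 1) * x) * S.card := by exact_mod_cast hbest
  have hatt' : (x : ℝ) * T.card ≤ edgeCount n l (T.map Fin.valEmbedding) * s := by
    exact_mod_cast hatt
  have hdens : density G T = (edgesWithin G T).ncard / T.card := rfl
  have hr := maxDensity_nonneg (G := G)
  have hET := ncard_edgesWithin_le (G := G) T
  have hET0 : (0 : ℝ) ≤ (edgesWithin G T).ncard := Nat.cast_nonneg _
  generalize maxDensity G = r at *
  generalize (edgeCount n l (S.map Fin.valEmbedding) : ℝ) = XS at *
  generalize (edgeCount n l (T.map Fin.valEmbedding) : ℝ) = XT at *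
  push_cast at hcS hcT
  rw [hSr] at hcS
  generalize ((edgesWithin G T).ncard : ℝ) = ET at *
  obtain ⟨y, hy⟩ : ∃ y : ℝ, y = x * w / (2 * s) := ⟨_, rfl⟩
  have hy0 : 0 ≤ y := by rw [hy]; positivity
  have hKε : 16 ≤ ε * K := by
    rw [hKR]
    rw [div_le_iff₀ hε] at hεk
    linarith
  -- The density of the sample on an optimal set is large.
  have e₁ : (K - 1) * r ≤ 2 * (K + 1) * y := by
    have h₁ : 2 * r * S.card * (1 - 1 / K) ≤ XS * w := by
      have h₂ := mul_le_mul_of_nonneg_right hcS hwR.le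
      have h₃ : -(1 / K * (2 * r / w * S.card)) * w = -(2 * r * S.card * (1 / (K : ℝ))) := by
        field_simp
      have h₄ : (XS - 2 * (r * S.card) / w) * w = XS * w - 2 * r * S.card := by
        field_simp
      rw [h₃, h₄] at h₂
      linarith
    have h₂ := mul_le_mul_of_nonneg_right h₁ (show 0 ≤ K * (s : ℝ) by positivity)
    have h₃ := mul_le_mul_of_nonneg_right hbest' hwR.le
    have h₄ : 2 * r * S.card * (1 - 1 / K) * (K * (s : ℝ)) =
        (K - 1) * r * (2 * s * S.card) := by
      field_simp
    have h₅ : 2 * ((K + 1) * x) * S.card * (w : ℝ) = 2 * (K + 1) * y * (2 * s * S.card) := by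
      rw [hy]; field_simp
    rw [h₄] at h₂
    rw [h₅] at h₃
    refine le_of_mul_le_mul_right (a := 2 * s * (S.card : ℝ)) ?_ (by positivity)
    linarith
  -- The density of the sample on the output set is not much larger than that of the graph.
  have e₂ : y ≤ ET / T.card + r / K := by
    have h₁ : XT * w ≤ 2 * ET + 2 * r * T.card / K := by
      have h₂ := mul_le_mul_of_nonneg_right hcT hwR.le
      have h₃ : 1 / K * (2 * r / w * T.card) * (w : ℝ) = 2 * r * T.card / K := by
        field_simp
      have h₄ : (XT - 2 * ET / w) * w = XT * w - 2 * ET := by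
        field_simp
      rw [h₃, h₄] at h₂
      linarith
    have h₂ := mul_le_mul_of_nonneg_right hatt' hwR.le
    have h₃ := mul_le_mul_of_nonneg_right h₁ hsR.le
    refine le_of_mul_le_mul_right (a := 2 * s * (T.card : ℝ)) ?_ (by positivity)
    calc y * (2 * s * T.card) = x * T.card * w := by rw [hy]; field_simp
      _ ≤ XT * s * w := h₂
      _ = XT * w * s := by ring
      _ ≤ (2 * ET + 2 * r * T.card / K) * s := h₃
      _ = _ := by field_simp
  have e₃ : ET / T.card ≤ r := (div_le_iff₀ hTR).2 hET
  have hη : ((x * w * K : ℕ) : ℝ) / (2 * (s * (K + 1)) : ℕ) = y * K / (K + 1) := by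
    rw [hy]; push_cast; field_simp
  have hsK : s * (K + 1) ≠ 0 := (Nat.mul_pos hO.pos (Nat.succ_pos K)).ne'
  obtain ⟨g₁, g₂, g₃⟩ := approx_of_bounds hK16 hKε hr hy0 (div_nonneg hET0 hTR.le) e₁ e₂ e₃
  rw [hη, hdens]
  exact ⟨by omega, g₁, g₂, hTne, g₃⟩

end Correctness

section Final

variable {n : ℕ} {G : SimpleGraph (Fin n)} {I : IncidenceList G}

theorem log_le_size (hn : 1 ≤ n) : Real.log n ≤ n.size := by
  have h₁ : (n : ℝ) ≤ Real.exp 1 ^ n.size := by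
    have h₂ : (n : ℝ) < 2 ^ n.size := by exact_mod_cast Nat.lt_size_self n
    have h₃ : (2 : ℝ) ≤ Real.exp 1 := by
      have := Real.add_one_le_exp 1
      linarith
    exact h₂.le.trans (pow_le_pow_left₀ zero_le_two h₃ _)
  rw [← Real.exp_nat_mul, mul_one] at h₁
  exact (Real.log_le_iff_le_exp (by exact_mod_cast hn)).2 h₁

/-- With high probability the sample is concentrated. If `w` is the quotient of the sum of the degrees
and `q`, then the expected number of sampled pairs inside a densest set with `s` nodes is of the
order `s q / n`; otherwise `w = 1`, and the sample is the whole graph. -/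
theorem sample_concentrated {c k q : ℕ} (hn : 1 ≤ n) (hk : 1 ≤ k)
    (hq : q = 1024 * (c + 3) * n.size * k * k * n) :
    (sample I (sampleWidth I q)).toOuterMeasure
      {l | ¬ Concentrated I (sampleWidth I q) (1 / (16 * k : ℕ)) l} ≤ ((n : ℝ≥0∞) ^ c)⁻¹ := by
  have hw := sampleWidth_pos (I := I) q
  -- For `n = 1` the bound is `1`; the estimates below need `n ≥ 2`.
  rcases hn.eq_or_lt with rfl | hn2
  · simp only [Nat.cast_one, one_pow, inv_one]
    refine (MeasureTheory.measure_mono (Set.subset_univ _)).trans (le_of_eq ?_)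
    rw [PMF.toOuterMeasure_apply_eq_one_iff]
    exact Set.subset_univ _
  have hr := maxDensity_nonneg (G := G)
  by_cases hD : I.totalDegree / q = 0
  · have hw1 : sampleWidth I q = 1 := by simp [sampleWidth, hD]
    rw [hw1]
    refine le_of_eq_of_le ?_ bot_le
    refine (PMF.toOuterMeasure_apply_eq_zero_iff _ _).2 (Set.disjoint_left.2 fun l hl hl' => hl' ?_)
    intro T _
    rw [edgeCount_sample_one (map_val_subset T) hl]
    simp only [Nat.cast_one, div_one, sub_self, abs_zero]
    positivity
  have hwq : sampleWidth I q * q ≤ I.totalDegree := by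
    rw [sampleWidth, if_neg hD, add_zero]
    exact Nat.div_mul_le_self _ _
  generalize sampleWidth I q = w at *
  have hwR : (0 : ℝ) < w := by exact_mod_cast hw
  have hnR : (2 : ℝ) ≤ n := by exact_mod_cast hn2
  have hkR : (0 : ℝ) < k := by exact_mod_cast hk
  have hr' : (q : ℝ) / n ≤ 2 * maxDensity G / w := by
    have h₁ : (I.totalDegree : ℝ) ≤ 2 * (maxDensity G * n) := by
      rw [totalDegree_eq, slots_eq]
      push_cast
      have h := ncard_edgesWithin_le (G := G) Finset.univ
      rw [Finset.card_univ, Fintype.card_fin] at h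
      linarith
    have h₂ : (w * q : ℝ) ≤ I.totalDegree := by exact_mod_cast hwq
    rw [div_le_div_iff₀ (by linarith) hwR]
    linarith
  have hqn : (q : ℝ) / n = 1024 * (c + 3) * n.size * k * k := by
    rw [hq]
    push_cast
    field_simp
  have hexp : Real.exp (-((1 / (16 * k : ℕ) : ℝ) ^ 2 * (2 * maxDensity G / w) / 4)) ≤
      ((n : ℝ) ^ (c + 3))⁻¹ := by
    rw [← Real.exp_log (show (0 : ℝ) < ((n : ℝ) ^ (c + 3))⁻¹ by positivity), Real.exp_le_exp,
      Real.log_inv, Real.log_pow, neg_le_neg_iff]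
    have h₁ : ((1 / (16 * k : ℕ) : ℝ) ^ 2 * (q / n) / 4) = (c + 3) * n.size := by
      rw [hqn]
      push_cast
      field_simp
      ring
    calc ((c + 3 : ℕ) : ℝ) * Real.log n ≤ (c + 3) * n.size := by
          push_cast
          exact mul_le_mul_of_nonneg_left (log_le_size hn) (by positivity)
      _ = (1 / (16 * k : ℕ) : ℝ) ^ 2 * (q / n) / 4 := h₁.symm
      _ ≤ _ := by gcongr
  have hy : (n : ℝ) * ((n : ℝ) ^ (c + 3))⁻¹ = ((n : ℝ) ^ (c + 2))⁻¹ := by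
    rw [pow_succ]
    field_simp
  have hn4 : (4 : ℝ) ≤ (n : ℝ) ^ 2 := by nlinarith
  have hnc : (1 : ℝ) ≤ (n : ℝ) ^ c := one_le_pow₀ (by linarith)
  have hn4c : 4 * (n : ℝ) ^ c ≤ (n : ℝ) ^ (c + 2) := by
    rw [pow_add, mul_comm]
    exact mul_le_mul_of_nonneg_left hn4 (by positivity)
  have key := exists_deviation_le (I := I) (n := n) hw
    (δ := 1 / (16 * k : ℕ)) (r := 2 * maxDensity G / w) (y := ((n : ℝ) ^ (c + 3))⁻¹)
    (by positivity) ?_ ?_ hexp ?_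
  · refine (MeasureTheory.measure_mono fun l hl => ?_).trans (key.trans ?_)
    · simp only [Concentrated, Set.mem_ofPred_eq, not_forall, not_le] at hl
      obtain ⟨T, hT, h⟩ := hl
      exact ⟨T, hT, h⟩
    · rw [hy, ← ENNReal.ofReal_natCast n, ← ENNReal.ofReal_pow (by positivity),
        ← ENNReal.ofReal_inv_of_pos (by positivity)]
      refine ENNReal.ofReal_le_ofReal ?_
      rw [← div_eq_mul_inv, div_le_iff₀ (by positivity)]
      have h₁ := mul_le_mul_of_nonneg_left hn4c (show 0 ≤ ((n : ℝ) ^ c)⁻¹ by positivity)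
      have h₂ : ((n : ℝ) ^ c)⁻¹ * (4 * (n : ℝ) ^ c) = 4 := by field_simp
      linarith
  · rw [div_le_one (by positivity)]
    have : 1 ≤ 16 * k := by omega
    exact_mod_cast this
  · intro T
    rw [slots_eq]
    have h := ncard_edgesWithin_le (G := G) T
    rw [div_le_iff₀ hwR]
    have h' : 2 * maxDensity G / w * T.card * w = 2 * (maxDensity G * T.card) := by field_simp
    rw [h']
    push_cast
    linarith
  · rw [hy]
    refine inv_le_of_inv_le₀ (by norm_num) ?_
    norm_num
    linarith

/-! ### Resources -/

/-- There are at most `D / w + n` draws, where `D` is the sum of the degrees. -/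
theorem sampleSize_le {q : ℕ} (hq : 0 < q) : sampleSize I (sampleWidth I q) ≤ 2 * q + n := by
  have hw := sampleWidth_pos (I := I) q
  obtain ⟨w, hw'⟩ : ∃ w, w = sampleWidth I q := ⟨_, rfl⟩
  rw [← hw'] at hw ⊢
  have h₁ : sampleSize I w * w ≤ I.totalDegree + n * w := by
    rw [sampleSize, Finset.sum_mul]
    calc ∑ v ∈ Finset.range n, intervals I w v * w
        ≤ ∑ v ∈ Finset.range n, (I.degreeQuery v + w) := Finset.sum_le_sum fun v _ => by
          have := Nat.div_mul_le_self (I.degreeQuery v + w - 1) w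
          rw [intervals]
          omega
      _ = _ := by
        rw [Finset.sum_add_distrib, Finset.sum_const, Finset.card_range, smul_eq_mul]
        rfl
  have h₂ : I.totalDegree ≤ 2 * q * w := by
    have h₃ := Nat.lt_div_mul_add (a := I.totalDegree) hq
    rw [hw', sampleWidth]
    split_ifs with h
    · rw [h] at h₃ ⊢
      omega
    · have h₄ : 1 * q ≤ I.totalDegree / q * q := Nat.mul_le_mul_right q (Nat.pos_of_ne_zero h)
      have h₅ : 2 * q * (I.totalDegree / q + 0) = 2 * (I.totalDegree / q * q) := by ring
      omega
  refine Nat.le_of_mul_le_mul_right (c := w) ?_ hw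
  rw [add_mul]
  omega

theorem size_le_log {m : ℕ} (hm : 1 ≤ m) : (m.size : ℝ) ≤ 1 + 2 * Real.log m := by
  have hpos := Nat.size_pos.2 hm
  have h₁ : 2 ^ (m.size - 1) ≤ m := Nat.lt_size.1 (by omega)
  have h₂ : (2 : ℝ) ^ (m.size - 1) ≤ m := by exact_mod_cast h₁
  have h₃ := Real.log_le_log (by positivity) h₂
  rw [Real.log_pow, Nat.cast_sub hpos, Nat.cast_one] at h₃
  have h₄ := Real.log_two_gt_d9
  have h₅ : (0 : ℝ) ≤ m.size - 1 := by
    have : (1 : ℝ) ≤ m.size := by exact_mod_cast hpos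
    linarith
  nlinarith

theorem numRegs_mainProg (M : ℕ) : (mainProg M).numRegs = 26 := rfl

/-- If `p` runs with a ghost value of distribution `μ`, then a set of final configurations is at most
as probable as any set of ghost values that contains the ghost value of every run ending in it. -/
theorem Exec.toOuterMeasure_run_le {α : Type} {p : Prog} {s : State} {t : ℕ} {ν : PMF (α × State)}
    (h : Exec I p s t ν) (E : Set Config) (F : Set α)
    (hF : ∀ x ∈ ν.support, (([], x.2) : Config) ∈ E → x.1 ∈ F) :
    (run I t ([p], s)).toOuterMeasure E ≤ (ν.map Prod.fst).toOuterMeasure F := by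
  rw [h.run_eq, PMF.toOuterMeasure_map_apply, PMF.toOuterMeasure_map_apply]
  exact PMF.toOuterMeasure_mono _ fun x hx => hF x hx.2 hx.1

theorem within_init {k W A : ℕ} (hn : n ≤ W) (hk : k ≤ W) : (State.init n k).Within W A where
  maxWord := max_le hn hk
  memTop := Nat.zero_le _
  reg r := by
    simp only [State.init]
    split_ifs
    exacts [hn, hk, Nat.zero_le _]
  mem _ := Nat.zero_le _

/-- The number of steps in terms of `q`, the order of the size of the sample. -/
theorem time_le {k n q J S : ℕ} (hk : 1 ≤ k) (hS : 1 ≤ S) (hn : n ≤ q) (hq : 1 ≤ q) (hSq : S ≤ q)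
    (hJ : J ≤ 2 * q + n) :
    S * 4 + n * 60 + J * 25 + 16 * k * S * (n * 55 + J * 43 + 62) + 100 ≤ 4200 * (k * S * q) := by
  have h₁ : k * S * (n * 55 + J * 43 + 62) ≤ k * S * (246 * q) :=
    Nat.mul_le_mul_left _ (by omega)
  have h₂ : 1 * q ≤ k * S * q := Nat.mul_le_mul_right _ (Nat.mul_pos hk hS)
  have h₃ : 16 * k * S * (n * 55 + J * 43 + 62) = 16 * (k * S * (n * 55 + J * 43 + 62)) := by ring
  have h₄ : k * S * (246 * q) = 246 * (k * S * q) := by ring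
  omega

/-- The word length, for words of cubic size in `q n`. -/
theorem size_le_of_le_cube {M k q m : ℕ} {e : ℝ} (hn : 1 ≤ n) (hM : 1 ≤ M) (hk : 1 ≤ k)
    (hke : (k : ℝ) ≤ e) (hq : q = M * n.size * k * k * n)
    (hm : m ≤ 40 * q * n * (40 * q * n) * (40 * q * n)) :
    (m.size : ℝ) ≤ (241 + 12 * M) * (1 + Real.log n + Real.log e) := by
  have hnR : (1 : ℝ) ≤ n := by exact_mod_cast hn
  have hMR : (1 : ℝ) ≤ M := by exact_mod_cast hM
  have hkR : (1 : ℝ) ≤ k := by exact_mod_cast hk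
  have hS : 1 ≤ n.size := Nat.size_pos.2 hn
  have hSR : (1 : ℝ) ≤ n.size := by exact_mod_cast hS
  have hln := Real.log_nonneg hnR
  have hle := Real.log_nonneg (hkR.trans hke)
  have hq1 : 1 ≤ q := hq ▸ Nat.mul_pos (Nat.mul_pos (Nat.mul_pos (Nat.mul_pos hM hS) hk) hk) hn
  have hqR : (1 : ℝ) ≤ q := by exact_mod_cast hq1
  have hW : 1 ≤ 40 * q * n * (40 * q * n) * (40 * q * n) := by
    have : 0 < 40 * q * n := by positivity
    exact Nat.mul_pos (Nat.mul_pos this this) this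
  have h₁ := (Nat.cast_le (α := ℝ)).2 (Nat.size_le_size hm)
  have h₂ := size_le_log hW
  have h₃ : Real.log (40 * q * n * (40 * q * n) * (40 * q * n) : ℕ) =
      3 * (Real.log 40 + Real.log q + Real.log n) := by
    have : ((40 * q * n * (40 * q * n) * (40 * q * n) : ℕ) : ℝ) = (40 * q * n) ^ 3 := by
      push_cast
      ring
    rw [this, Real.log_pow, Real.log_mul (by positivity) (by positivity),
      Real.log_mul (by positivity) (by positivity)]
    norm_num
  have h₄ : Real.log q = Real.log M + Real.log n.size + 2 * Real.log k + Real.log n := by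
    rw [hq]
    push_cast
    rw [Real.log_mul (by positivity) (by positivity), Real.log_mul (by positivity) (by positivity),
      Real.log_mul (by positivity) (by positivity), Real.log_mul (by positivity) (by positivity)]
    ring
  have h₅ : Real.log n.size ≤ Real.log n :=
    Real.log_le_log (by positivity) (by exact_mod_cast size_le_self n)
  have h₆ : Real.log k ≤ Real.log e := Real.log_le_log (by positivity) hke
  have h₇ : Real.log M ≤ M := Real.log_le_self (by positivity)
  have h₈ : Real.log 40 ≤ 40 := Real.log_le_self (by norm_num)
  have h₉ : 0 ≤ (M : ℝ) * Real.log n := by positivity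
  have h₁₀ : 0 ≤ (M : ℝ) * Real.log e := by positivity
  rw [h₃] at h₂
  nlinarith

/-- Each bound of the shape `a n (1 + log n)² (1 + 1 / ε)³` has the required form. -/
theorem le_mul_cube {a n L e : ℝ} (ha : 0 ≤ a) (hn : 0 ≤ n) (hL : 1 ≤ L) (he : 1 ≤ e) :
    a * n * L ^ 2 * e ^ 3 ≤ a * n * (L * e) ^ 3 := by
  have : L ^ 2 ≤ L ^ 3 := pow_le_pow_right₀ hL (by norm_num)
  calc a * n * L ^ 2 * e ^ 3 ≤ a * n * L ^ 3 * e ^ 3 := by gcongr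
    _ = a * n * (L * e) ^ 3 := by ring

end Final

end DensestSubgraph

open DensestSubgraph

theorem mainTheorem9 (c : ℕ) :
    ∃ (P : DensestSubgraph.Prog) (C k : ℕ),
      ∀ (ε : ℝ), 0 < ε → ∀ (n : ℕ), 1 ≤ n →
        ∀ (G : SimpleGraph (Fin n)) (I : DensestSubgraph.IncidenceList G),
          ∃ T : ℕ,
            (T : ℝ) ≤ C * n * ((1 + Real.log n) * (1 + 1 / ε)) ^ k ∧
            (∀ x ∈ (DensestSubgraph.run I T
                ([P], DensestSubgraph.State.init n ⌈1 / ε⌉₊)).support,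
              x.1 = [] ∧
              (x.2.queries : ℝ) ≤ C * n * ((1 + Real.log n) * (1 + 1 / ε)) ^ k ∧
              (DensestSubgraph.spaceBits P x.2 : ℝ) ≤
                C * n * ((1 + Real.log n) * (1 + 1 / ε)) ^ k ∧
              (x.2.wordBits : ℝ) ≤ C * (1 + Real.log n + Real.log (1 + 1 / ε))) ∧
            (DensestSubgraph.run I T
                ([P], DensestSubgraph.State.init n ⌈1 / ε⌉₊)).toOuterMeasure
              {x | ¬ DensestSubgraph.IsApproxSolution G (2 + ε) x.2} ≤ ((n : ENNReal) ^ c)⁻¹ := by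
  -- The deviation is tested at `δ = 1 / (16 k)`, and `δ² / 4 · (q / n) = (c + 3) · size n` for
  -- `M = 1024 (c + 3)`.
  obtain ⟨M, hM⟩ : ∃ M, M = 1024 * (c + 3) := ⟨_, rfl⟩
  -- The three summands are for the time, the space and the word length.
  refine ⟨mainProg M, 16800 * M + 136 * M * (241 + 12 * M) + (241 + 12 * M), 3, ?_⟩
  intro ε hε n hn G I
  obtain ⟨k, hk⟩ : ∃ k, k = ⌈1 / ε⌉₊ := ⟨_, rfl⟩
  rw [← hk]
  have hε' : 0 < 1 / ε := by positivity
  have hεk : 1 / ε ≤ k := hk ▸ Nat.le_ceil _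
  have hk1 : 1 ≤ k := hk ▸ Nat.ceil_pos.2 hε'
  have hke : (k : ℝ) ≤ 1 + 1 / ε := by
    rw [hk, add_comm]
    exact (Nat.ceil_lt_add_one hε'.le).le
  generalize 1 + 1 / ε = e at hke ⊢
  have hS : 1 ≤ n.size := Nat.size_pos.2 hn
  obtain ⟨q, hq⟩ : ∃ q, q = M * n.size * k * k * n := ⟨_, rfl⟩
  have hM1 : 16 ≤ M := by omega
  have hpos : 1 ≤ M * n.size * k * k :=
    Nat.mul_pos (Nat.mul_pos (Nat.mul_pos (by omega) hS) hk1) hk1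
  have hnq : n ≤ q := by
    rw [hq]
    exact Nat.le_mul_of_pos_left _ hpos
  have hkq : k ≤ q := by
    rw [hq, mul_right_comm]
    exact Nat.le_mul_of_pos_left _ (Nat.mul_pos (Nat.mul_pos (Nat.mul_pos (by omega) hS) hk1) hn)
  have hSq : n.size ≤ q := (size_le_self n).trans hnq
  have hJ : sampleSize I (sampleWidth I q) ≤ 2 * q + n := sampleSize_le (by omega)
  have hqn : q * 1 ≤ q * n := Nat.mul_le_mul_left q hn
  have hnn : n * n ≤ q * n := Nat.mul_le_mul_right n hnq
  have hB : 40 * q * n = 40 * (q * n) := by ring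
  have hBW : 40 * q * n ≤ 40 * q * n * (40 * q * n) * (40 * q * n) := by
    have : 0 < 40 * q * n := by omega
    rw [mul_assoc (40 * q * n)]
    exact Nat.le_mul_of_pos_right _ (Nat.mul_pos this this)
  have hw := sampleWidth_le (I := I) q
  -- Every word is a product of at most three numbers of size `O(q n)`.
  obtain ⟨ν, hν, hE, hQ⟩ := runs_mainProg (I := I) (B := 40 * q * n)
    (W := 40 * q * n * (40 * q * n) * (40 * q * n)) (ρ := (State.init n k).reg)
    hn hk1 hM1 hq rfl (by omega) (by omega) (by omega) le_rfl rfl rfl rfl (State.init n k) rfl rfl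
    (within_init (by omega) (by omega))
  have hT := time_le hk1 hS hnq (by omega) hSq hJ
  generalize n.size * 4 + n * 60 + sampleSize I (sampleWidth I q) * 25 + 16 * k * n.size *
    (n * 55 + sampleSize I (sampleWidth I q) * 43 + 62) + 100 = T at hE hT
  have hnR : (1 : ℝ) ≤ n := by exact_mod_cast hn
  have hL0 : 0 ≤ Real.log n := Real.log_nonneg hnR
  have hkR : (1 : ℝ) ≤ k := by exact_mod_cast hk1
  have he1 : 1 ≤ e := hkR.trans hke
  have hle : Real.log e ≤ e := Real.log_le_self (by linarith)
  have hSL : (n.size : ℝ) ≤ 2 * (1 + Real.log n) := (size_le_log hn).trans (by linarith)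
  have hqL : (q : ℝ) ≤ 2 * M * n * (1 + Real.log n) * e ^ 2 := by
    rw [hq]
    push_cast
    calc (M : ℝ) * n.size * k * k * n ≤ M * (2 * (1 + Real.log n)) * e * e * n := by gcongr
      _ = _ := by ring
  have hcube : ∀ a : ℝ, 0 ≤ a →
      a ≤ (16800 * M + 136 * M * (241 + 12 * M) + (241 + 12 * M) : ℕ) →
      a * n * (1 + Real.log n) ^ 2 * e ^ 3 ≤
        (16800 * M + 136 * M * (241 + 12 * M) + (241 + 12 * M) : ℕ) * n *
          ((1 + Real.log n) * e) ^ 3 := fun a ha ha' =>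
    (le_mul_cube ha (by linarith) (by linarith) he1).trans (by gcongr)
  have hTR : (T : ℝ) ≤ (16800 * M + 136 * M * (241 + 12 * M) + (241 + 12 * M) : ℕ) * n *
      ((1 + Real.log n) * e) ^ 3 := by
    refine le_trans ?_ (hcube (16800 * M) (by positivity) ?_)
    · calc (T : ℝ) ≤ 4200 * (k * n.size * q) := by exact_mod_cast hT
        _ ≤ 4200 * (e * (2 * (1 + Real.log n)) * (2 * M * n * (1 + Real.log n) * e ^ 2)) := by
          gcongr
        _ = _ := by ring
    · have : 16800 * M ≤ 16800 * M + 136 * M * (241 + 12 * M) + (241 + 12 * M) := by omega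
      exact_mod_cast this
  refine ⟨T, hTR, fun x hx => ?_, ?_⟩
  · have hqu := queries_le_of_mem_support_run hx
    rw [hE.run_eq, PMF.support_map] at hx
    obtain ⟨y, hy, rfl⟩ := hx
    obtain ⟨hWith, -⟩ := hQ y hy
    have hbits : (y.2.wordBits : ℝ) ≤ (241 + 12 * M) * (1 + Real.log n + Real.log e) :=
      size_le_of_le_cube hn (by omega) hk1 hke hq hWith.maxWord
    have hlog : 0 ≤ 1 + Real.log n + Real.log e := by
      have := Real.log_nonneg he1
      linarith
    refine ⟨rfl, le_trans ?_ hTR, ?_, hbits.trans ?_⟩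
    · have h0 : (State.init n k).queries = 0 := rfl
      rw [h0, zero_add] at hqu
      exact_mod_cast hqu
    · have hmem : (mainProg M).numRegs + y.2.memTop ≤ 34 * q := by
        have := hWith.memTop
        rw [numRegs_mainProg]
        omega
      refine le_trans ?_ (hcube (136 * M * (241 + 12 * M)) (by positivity) ?_)
      · calc (spaceBits (mainProg M) y.2 : ℝ)
            = ((mainProg M).numRegs + y.2.memTop : ℕ) * (y.2.wordBits : ℝ) := by
              rw [spaceBits, Nat.cast_mul]
          _ ≤ (34 * q : ℕ) * ((241 + 12 * M) * (1 + Real.log n + Real.log e)) := by gcongr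
          _ ≤ 34 * (2 * M * n * (1 + Real.log n) * e ^ 2) *
              ((241 + 12 * M) * (2 * (1 + Real.log n) * e)) := by
            push_cast
            have : 1 + Real.log n + Real.log e ≤ 2 * (1 + Real.log n) * e := by nlinarith
            gcongr
          _ = _ := by ring
      · push_cast
        linarith [show (0 : ℝ) ≤ M by positivity]
    · refine mul_le_mul_of_nonneg_right ?_ hlog
      push_cast
      have : (0 : ℝ) ≤ 16800 * M + 136 * M * (241 + 12 * M) := by positivity
      linarith
  · refine (hE.toOuterMeasure_run_le _
      {l | ¬ Concentrated I (sampleWidth I q) (1 / (16 * k : ℕ)) l} fun x hx hbad hl => ?_).trans ?_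
    · obtain ⟨-, O, a, d, z, s, hO, h0, h1, hm⟩ := hQ x hx
      exact hbad (hO.isApproxSolution hn hk1 hε hεk (sampleWidth_pos q) hl h0 h1 hm)
    · rw [hν]
      exact sample_concentrated hn hk1 (hM ▸ hq)
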